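/- Let $K$ be a field and let $(E,w)$ be a row-finite weighted graph: $E=(E^0,E^1,s,r)$ is a directed graph with source and range maps $s,r:E^1\to E^0$ such that every vertex emits only finitely many edges, and $w:E^1\to\{1,2,\dots\}$ is a map. For $v\in E^0$ put $w(v)=\max\{w(e)\mid e\in s^{-1}(v)\}$ (with $\max\emptyset=0$). The weighted Leavitt path algebra $L_K(E,w)$ is the (not necessarily unital) associative $K$-algebra generated by the vertices $v\in E^0$ and the symbols $e_i,e_i^*$ ($e\in E^1$, $1\le i\le w(e)$) subject to the relations 1. $uv=\delta_{uv}u$ for all $u,v\in E^0$; 2. $s(e)e_i=e_i=e_ir(e)$ and $r(e)e_i^*=e_i^*=e_i^*s(e)$ for all $e\in E^1$, $1\le i\le w(e)$; 3. $\sum_{e\in s^{-1}(v)}e_ie_j^*=\delta_{ij}v$ for all $v\in E^0$ and $1\le i,j\le w(v)$; 4. $\sum_{1\le i\le w(v)}e_i^*f_i=\delta_{ef}r(e)$ for all $v\in E^0$ and $e,f\in s^{-1}(v)$; where in 3 and 4 one sets $e_i=e_i^*=0$ whenever $i>w(e)$. Let $n=\sup\{w(e)\mid e\in E^1\}$ and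 let $\mathbb Z^{n}$ denote the free abelian group with basis $\{\epsilon_i\mid 1\le i\le n\}$ (with basis $\{\epsilon_i\mid i\geq 1\}$ if $n=\infty$). The standard grading of $L_K(E,w)$ is the $\mathbb Z^n$-grading with $\deg v=0$, $\deg e_i=\epsilon_i$, $\deg e_i^*=-\epsilon_i$. The algebra $L_K(E,w)$ is called locally finite if every homogeneous component of the standard grading is a finite-dimensional $K$-vector space. **Theorem.** If $L_K(E,w)$ is left Noetherian or right Noetherian (i.e. every ascending chain of left ideals, respectively of right ideals, becomes stationary), then $L_K(E,w)$ is locally finite. In particular, if $L_K(E,w)$ is Noetherian, then it is locally finite. -/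

import Mathlib

/-! ### Quotients of (not necessarily unital) associative algebras -/

section AlgQuotient

variable (K : Type*) {A : Type*} [Field K] [NonUnitalRing A] [Module K A]

/-- The two-sided (algebra) ideal generated by a set `S`: the smallest linear subspace that contains
`S` and is closed under left and right multiplication by arbitrary elements. -/
def idealSpan (S : Set A) : Submodule K A :=
  sInf {I : Submodule K A | S ⊆ I ∧ ∀ a x : A, x ∈ I → a * x ∈ I ∧ x * a ∈ I}

theorem subset_idealSpan (S : Set A) : S ⊆ idealSpan K S := by
  intro x hx
  refine Submodule.mem_sInf.2 fun I hI => hI.1 hx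

theorem mul_left_mem_idealSpan {S : Set A} (a : A) {x : A} (hx : x ∈ idealSpan K S) :
    a * x ∈ idealSpan K S :=
  Submodule.mem_sInf.2 fun I hI => (hI.2 a x (Submodule.mem_sInf.1 hx I hI)).1

theorem mul_right_mem_idealSpan {S : Set A} (a : A) {x : A} (hx : x ∈ idealSpan K S) :
    x * a ∈ idealSpan K S :=
  Submodule.mem_sInf.2 fun I hI => (hI.2 a x (Submodule.mem_sInf.1 hx I hI)).2

/-- The quotient of the algebra `A` by the two-sided ideal generated by `S`. -/
def AlgQuotient (S : Set A) : Type _ := A ⧸ idealSpan K S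

namespace AlgQuotient

variable (S : Set A)

instance : AddCommGroup (AlgQuotient K S) := inferInstanceAs (AddCommGroup (A ⧸ idealSpan K S))

instance : Module K (AlgQuotient K S) := inferInstanceAs (Module K (A ⧸ idealSpan K S))

/-- The canonical linear projection onto the quotient algebra. -/
def mk : A →ₗ[K] AlgQuotient K S := (idealSpan K S).mkQ

theorem mk_surjective : Function.Surjective (mk K S) := Submodule.mkQ_surjective _

theorem mk_eq_mk {x y : A} : mk K S x = mk K S y ↔ x - y ∈ idealSpan K S :=
  Submodule.Quotient.eq (idealSpan K S)

/-- The multiplication of the quotient algebra is induced by that of `A`. -/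
instance : Mul (AlgQuotient K S) where
  mul := Quotient.map₂ (· * ·) (by
    intro a b hab c d hcd
    rw [← Quotient.eq_iff_equiv] at hab hcd ⊢
    have h₁ : a - b ∈ idealSpan K S := (mk_eq_mk K S).1 hab
    have h₂ : c - d ∈ idealSpan K S := (mk_eq_mk K S).1 hcd
    refine (mk_eq_mk K S).2 ?_
    have h : a * c - b * d = (a - b) * c + b * (c - d) := by noncomm_ring
    rw [h]
    exact add_mem (mul_right_mem_idealSpan K c h₁) (mul_left_mem_idealSpan K b h₂))

theorem mk_mul (x y : A) : mk K S (x * y) = mk K S x * mk K S y := rfl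

instance : NonUnitalRing (AlgQuotient K S) where
  __ := (inferInstance : AddCommGroup (AlgQuotient K S))
  __ := (inferInstance : Mul (AlgQuotient K S))
  left_distrib a b c := by
    obtain ⟨a, rfl⟩ := mk_surjective K S a
    obtain ⟨b, rfl⟩ := mk_surjective K S b
    obtain ⟨c, rfl⟩ := mk_surjective K S c
    simp only [← mk_mul, ← map_add, mul_add]
  right_distrib a b c := by
    obtain ⟨a, rfl⟩ := mk_surjective K S a
    obtain ⟨b, rfl⟩ := mk_surjective K S b
    obtain ⟨c, rfl⟩ := mk_surjective K S c
    simp only [← mk_mul, ← map_add, add_mul]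
  zero_mul a := by
    obtain ⟨a, rfl⟩ := mk_surjective K S a
    rw [← map_zero (mk K S), ← mk_mul, zero_mul]
  mul_zero a := by
    obtain ⟨a, rfl⟩ := mk_surjective K S a
    rw [← map_zero (mk K S), ← mk_mul, mul_zero]
  mul_assoc a b c := by
    obtain ⟨a, rfl⟩ := mk_surjective K S a
    obtain ⟨b, rfl⟩ := mk_surjective K S b
    obtain ⟨c, rfl⟩ := mk_surjective K S c
    simp only [← mk_mul, mul_assoc]

instance [IsScalarTower K A A] : IsScalarTower K (AlgQuotient K S) (AlgQuotient K S) where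
  smul_assoc k a b := by
    obtain ⟨a, rfl⟩ := mk_surjective K S a
    obtain ⟨b, rfl⟩ := mk_surjective K S b
    simp only [smul_eq_mul, ← mk_mul, ← map_smul, smul_mul_assoc]

instance [SMulCommClass K A A] : SMulCommClass K (AlgQuotient K S) (AlgQuotient K S) where
  smul_comm k a b := by
    obtain ⟨a, rfl⟩ := mk_surjective K S a
    obtain ⟨b, rfl⟩ := mk_surjective K S b
    simp only [smul_eq_mul, ← mk_mul, ← map_smul, mul_smul_comm]

end AlgQuotient

end AlgQuotient

/-! ### Directed graphs and path algebras -/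

/-- A directed graph with vertex set `V` and edge set `E`. -/
structure DirGraph (V : Type*) (E : Type*) where
  /-- the source of an edge -/
  s : E → V
  /-- the range of an edge -/
  r : E → V

namespace DirGraph

variable {V E : Type*} (G : DirGraph V E)

/-- The double graph: `Sum.inl e` is the real edge `e`, `Sum.inr e` is the ghost edge `e*`. -/
def double : DirGraph V (E ⊕ E) where
  s := Sum.elim G.s G.r
  r := Sum.elim G.r G.s

variable (K : Type*) [Field K]

/-- The free associative (non-unital) `K`-algebra on a set `X`: it has the nonempty words over `X`
as a basis, multiplied by juxtaposition. -/
abbrev FreeAlg (X : Type*) : Type _ := MonoidAlgebra K (FreeSemigroup X)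

/-- A letter as an element of the free algebra. -/
noncomputable def FreeAlg.letter {X : Type*} (x : X) : FreeAlg K X :=
  MonoidAlgebra.single (FreeSemigroup.of x) 1

open Classical in
/-- The relators `vw - δ_{vw} v`, `s(e)e - e`, `e r(e) - e` of the path algebra. -/
inductive PathRelator : FreeAlg K (V ⊕ E) → Prop
  | vertex (v w : V) : PathRelator
      (FreeAlg.letter K (Sum.inl v) * FreeAlg.letter K (Sum.inl w)
        - if v = w then FreeAlg.letter K (Sum.inl v) else 0)
  | source (e : E) : PathRelator
      (FreeAlg.letter K (Sum.inl (G.s e)) * FreeAlg.letter K (Sum.inr e)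
        - FreeAlg.letter K (Sum.inr e))
  | range (e : E) : PathRelator
      (FreeAlg.letter K (Sum.inr e) * FreeAlg.letter K (Sum.inl (G.r e))
        - FreeAlg.letter K (Sum.inr e))

/-- The path algebra of a directed graph. -/
abbrev PathAlgebra : Type _ := AlgQuotient K {x : FreeAlg K (V ⊕ E) | G.PathRelator K x}

/-- The image of a letter (a vertex or an edge) in the path algebra. -/
noncomputable def PathAlgebra.letter (x : V ⊕ E) : G.PathAlgebra K :=
  AlgQuotient.mk K _ (FreeAlg.letter K x)

end DirGraph

/-! ### Weighted graphs and weighted Leavitt path algebras -/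

/-- A row-finite weighted graph with vertex set `V` and edge set `E`. -/
structure WeightedGraph (V : Type*) (E : Type*) extends DirGraph V E where
  /-- the weight of an edge, a positive integer -/
  w : E → ℕ
  w_pos : ∀ e, 0 < w e
  rowFinite : ∀ v, {e | s e = v}.Finite

namespace WeightedGraph

variable {V E : Type*} (G : WeightedGraph V E)

/-- The finite set of edges emitted by the vertex `v`. -/
noncomputable def out (v : V) : Finset E := (G.rowFinite v).toFinset

/-- The weight of a vertex: the maximal weight of an edge that it emits, `0` for a sink. -/
noncomputable def vertexWeight (v : V) : ℕ := (G.out v).sup G.w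

/-- The edges `e_1, …, e_{w(e)}` of the directed graph associated to the weighted graph. The index
is shifted: `⟨e, i⟩` with `i : Fin (w e)` is `e_{i+1}`. -/
abbrev HatEdge : Type _ := Σ e : E, Fin (G.w e)

/-- The directed graph associated to the weighted graph. -/
def hat : DirGraph V G.HatEdge where
  s x := G.s x.1
  r x := G.r x.1

/-- Vertices, real edges `e_i` and ghost edges `e_i*`. -/
abbrev Letter : Type _ := V ⊕ (G.HatEdge ⊕ G.HatEdge)

variable (K : Type*) [Field K]

/-- The path algebra of the double graph of the associated directed graph. -/
abbrev DPathAlgebra : Type _ := G.hat.double.PathAlgebra K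

/-- A vertex in the path algebra of the double graph. -/
noncomputable def dVertex (v : V) : G.DPathAlgebra K :=
  DirGraph.PathAlgebra.letter G.hat.double K (Sum.inl v)

/-- The real edge `e_{i+1}` in the path algebra of the double graph; zero if `i + 1 > w(e)`. -/
noncomputable def dReal (e : E) (i : ℕ) : G.DPathAlgebra K :=
  if h : i < G.w e then
    DirGraph.PathAlgebra.letter G.hat.double K (Sum.inr (Sum.inl ⟨e, ⟨i, h⟩⟩)) else 0

/-- The ghost edge `e_{i+1}*` in the path algebra of the double graph; zero if `i + 1 > w(e)`. -/
noncomputable def dGhost (e : E) (i : ℕ) : G.DPathAlgebra K :=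
  if h : i < G.w e then
    DirGraph.PathAlgebra.letter G.hat.double K (Sum.inr (Sum.inr ⟨e, ⟨i, h⟩⟩)) else 0

open Classical in
/-- The relators of the weighted Leavitt path algebra:
`∑_{e ∈ s⁻¹(v)} e_i e_j* - δ_{ij} v` for a vertex `v` and `1 ≤ i, j ≤ w(v)`, and
`∑_{1 ≤ i ≤ w(v)} e_i* f_i - δ_{ef} r(e)` for a vertex `v` and `e, f ∈ s⁻¹(v)`
(with indices shifted by one). -/
inductive LeavittRelator : G.DPathAlgebra K → Prop
  | row (v : V) (i j : ℕ) (hi : i < G.vertexWeight v) (hj : j < G.vertexWeight v) : LeavittRelator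
      ((∑ e ∈ G.out v, G.dReal K e i * G.dGhost K e j) - if i = j then G.dVertex K v else 0)
  | col (v : V) (e f : E) (he : G.s e = v) (hf : G.s f = v) : LeavittRelator
      ((∑ i ∈ Finset.range (G.vertexWeight v), G.dGhost K e i * G.dReal K f i)
        - if e = f then G.dVertex K (G.r e) else 0)

/-- The weighted Leavitt path algebra `L_K(E,w)`. -/
abbrev LeavittPathAlgebra : Type _ := AlgQuotient K {x : G.DPathAlgebra K | G.LeavittRelator K x}

/-! ### The standard grading -/

/-- The index set `{1, …, n}` of `ℤⁿ` for `n = max {w(e) | e ∈ E¹}`, shifted to `{0, …, n-1}`; it is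
all of `ℕ` if the weights are unbounded. -/
abbrev GradeIndex : Type := {i : ℕ // ∃ e : E, i < G.w e}

/-- The standard grading group `ℤⁿ`, where `n = max {w(e) | e ∈ E¹}`. -/
abbrev GradeGroup : Type := G.GradeIndex →₀ ℤ

/-- The degrees of the generators: `deg v = 0`, `deg e_i = ε_i`, `deg e_i* = -ε_i`. -/
noncomputable def letterDegree : G.Letter → G.GradeGroup
  | Sum.inl _ => 0
  | Sum.inr (Sum.inl x) => Finsupp.single ⟨x.2, x.1, x.2.isLt⟩ 1
  | Sum.inr (Sum.inr x) => -Finsupp.single ⟨x.2, x.1, x.2.isLt⟩ 1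

/-- The degree of a nonempty word: the sum of the degrees of its letters. -/
noncomputable def wordDegree (x : FreeSemigroup G.Letter) : G.GradeGroup :=
  Multiplicative.toAdd (FreeSemigroup.lift (fun y => Multiplicative.ofAdd (G.letterDegree y)) x)

/-- The image of a nonempty word in the weighted Leavitt path algebra. -/
noncomputable def ofWord (x : FreeSemigroup G.Letter) : G.LeavittPathAlgebra K :=
  AlgQuotient.mk K _ (AlgQuotient.mk K _ (MonoidAlgebra.single x (1 : K)))

/-- The homogeneous component of degree `g` of `L_K(E,w)` with respect to the standard grading. -/
noncomputable def homogeneousComponent (g : G.GradeGroup) : Submodule K (G.LeavittPathAlgebra K) :=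
  Submodule.span K {a | ∃ x : FreeSemigroup G.Letter, G.wordDegree x = g ∧ a = G.ofWord K x}

/-- `L_K(E,w)` is locally finite: every homogeneous component of the standard grading is
finite-dimensional. -/
def IsLocallyFinite : Prop :=
  ∀ g : G.GradeGroup, FiniteDimensional K (G.homogeneousComponent K g)

end WeightedGraph

/-! ### Noetherian rings without a unit -/

/-- A not necessarily unital ring is left Noetherian if every ascending chain of left ideals
becomes stationary. -/
def IsLeftNoetherianRng (R : Type*) [NonUnitalRing R] : Prop :=
  ∀ I : ℕ →o AddSubgroup R, (∀ (n : ℕ) (a x : R), x ∈ I n → a * x ∈ I n) →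
    ∃ n, ∀ m, n ≤ m → I m = I n

/-- A not necessarily unital ring is right Noetherian if every ascending chain of right ideals
becomes stationary. -/
def IsRightNoetherianRng (R : Type*) [NonUnitalRing R] : Prop :=
  ∀ I : ℕ →o AddSubgroup R, (∀ (n : ℕ) (a x : R), x ∈ I n → x * a ∈ I n) →
    ∃ n, ∀ m, n ≤ m → I m = I n

/-!
The entries of a weighted Leavitt path algebra `L` form, for each vertex `v`, a matrix `(e_i)` with
rows `(v, i)` and columns `e ∈ s⁻¹(v)`; the relations say that `(e_i*)` is its inverse. Rows and
columns (the *nodes*) thus play symmetric roles: a letter is a pair `(x, t)` of nodes on opposite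
sides, and all relations read `∑ t, (x, t) (t, y) = δ_{xy}`. On either side one *special* node is
chosen whose line has no forced zeros (the first row, the column of an edge of maximal weight), and
the relations are solved for the product of two letters that meet in a special node. A word is
*reduced* if no such product occurs in it. Letters act on the space spanned by the words by a rule
that needs a single rewriting step (`NodeSystem.isRep_op`); it follows that the reduced words are
linearly independent in `L`, and also that they span it (`NodeSystem.IsModel.mul_vertex_eq`).

As `L` has an involution, it may be assumed to be left Noetherian. Multiplication from the left
cannot cancel a word that begins in a nonspecial node, so there is no infinite family of such words
of which none is a suffix of another; hence a path from a nonspecial node can enter a closed path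
only by its own last letter (`NodeSystem.NoBranch`). Moreover one-sided inverses in `L` are
two-sided (`IsLeftNoetherianRng.mul_eq_of_mul_eq`), which excludes certain closed paths
(`NodeSystem.NoIsometry`).

The rest is combinatorics of reduced words. A word that begins in a nonspecial node does not end in
one: otherwise there would be such a word `w` that begins in a row, and then the closed path `w w*`
can be entered in a second way. Therefore each letter of a word `c` that begins in a nonspecial
node is the only one in its line, so that `c c*` is a vertex; if `c` is closed, then `c* c` is a
reduced word different from a vertex, which is impossible. So all letters that occur on closed
paths (the *recurrent* letters) are special on both sides. It follows that a path between recurrent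
letters does not switch between real and ghost letters
(`NodeSystem.Recurrent.row_iff_of_reflTransGen`). In a reduced word the other letters occur at most
once, so its length is bounded by its total degree up to a constant
(`NodeSystem.length_le_of_isChain`). As the graph is finite, there are finitely many reduced words
of a given total degree, and they span the homogeneous components.
-/

/-! ### Nodes, letters and links -/

/-- The index data of a family of mutually inverse matrices. The nodes are the row and the column
indices of the matrices, `nbr x` is the set of the indices `t` on the other side such that the
`(x,t)` entry is not forced to vanish, and `sp x` is a chosen index on the other side whose line has
no forced zeros. The entry at `(x, t)` is an arrow from `vtx x` to `vtx t`. -/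
structure NodeSystem (V N : Type*) where
  /-- the vertex at a node -/
  vtx : N → V
  /-- the nodes on the other side that share a nonzero entry with the given one -/
  nbr : N → Finset N
  /-- the special node on the other side -/
  sp : N → N
  /-- the row indices -/
  row : N → Prop
  mem_symm : ∀ {x t}, t ∈ nbr x → x ∈ nbr t
  sp_mem : ∀ x, sp x ∈ nbr x
  sp_eq : ∀ {x y t}, t ∈ nbr x → t ∈ nbr y → sp x = sp y
  row_iff : ∀ {x t}, t ∈ nbr x → (row t ↔ ¬ row x)
  vtx_sp_sp : ∀ {x}, row x → vtx (sp (sp x)) = vtx x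
  sp_eq_of_row : ∀ {x y}, row x → row y → vtx x = vtx y → sp x = sp y

namespace NodeSystem

open Relation

variable {V N : Type*} (S : NodeSystem V N)

/-- A node is special if it is the chosen node on its side. -/
def Special (x : N) : Prop := S.sp (S.sp x) = x

/-- The relation `Link (x, t) (x', t')` says that the letters `(x, t)` and `(x', t')` may follow
each other in a reduced word: they are composable, and they do not meet in a special node. -/
def Link (a b : N × N) : Prop :=
  a.2 ∈ S.nbr a.1 ∧ b.2 ∈ S.nbr b.1 ∧ S.vtx a.2 = S.vtx b.1 ∧ ¬ (a.2 = b.1 ∧ S.Special a.2)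

variable {S}

theorem special_sp (x : N) : S.Special (S.sp x) :=
  S.sp_eq (S.mem_symm (S.sp_mem _)) (S.sp_mem x)

theorem eq_sp_of_special {x t : N} (h : t ∈ S.nbr x) (ht : S.Special t) : t = S.sp x :=
  ht.symm.trans (S.sp_eq (S.mem_symm (S.sp_mem t)) h)

theorem Special.mem_nbr {x y t : N} (hy : S.Special y) (h : S.sp x = S.sp y) (ht : t ∈ S.nbr x) :
    y ∈ S.nbr t := by
  have : S.sp t = y := by
    rw [S.sp_eq (S.mem_symm ht) (S.mem_symm (S.sp_mem x)), h]
    exact hy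
  exact this ▸ S.sp_mem t

theorem Link.swap {a b : N × N} (h : S.Link a b) : S.Link b.swap a.swap :=
  ⟨S.mem_symm h.2.1, S.mem_symm h.1, h.2.2.1.symm,
    fun ⟨h₁, h₂⟩ => h.2.2.2 ⟨h₁.symm, (show b.1 = a.2 from h₁) ▸ h₂⟩⟩

theorem link_swap_self {a : N × N} (ha : a.2 ∈ S.nbr a.1) (h : ¬ S.Special a.2) :
    S.Link a a.swap :=
  ⟨ha, S.mem_symm ha, rfl, fun h' => h h'.2⟩

theorem swap_link_self {a : N × N} (ha : a.2 ∈ S.nbr a.1) (h : ¬ S.Special a.1) :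
    S.Link a.swap a :=
  link_swap_self (a := a.swap) (S.mem_symm ha) h

theorem reflTransGen_swap {a b : N × N} (h : ReflTransGen S.Link a b) :
    ReflTransGen S.Link b.swap a.swap :=
  h.swap.lift Prod.swap fun _ _ h => h.swap

theorem transGen_swap {a b : N × N} (h : TransGen S.Link a b) :
    TransGen S.Link b.swap a.swap :=
  h.swap.lift Prod.swap fun _ _ h => h.swap

/-- Whether a letter can be reached depends on its first node only. -/
theorem transGen_congr_right {a : N × N} {x t t' : N} (h : TransGen S.Link a (x, t))
    (ht' : t' ∈ S.nbr x) : TransGen S.Link a (x, t') := by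
  obtain ⟨c, hc, hl⟩ := TransGen.tail'_iff.1 h
  exact TransGen.tail' hc ⟨hl.1, ht', hl.2.2⟩

theorem eq_of_special_of_row {x y : N} (hx : S.Special x) (hy : S.Special y) (rx : S.row x)
    (ry : S.row y) (h : S.vtx x = S.vtx y) : x = y := by
  rw [← hx, ← hy, S.sp_eq_of_row rx ry h]

/-- A path that leaves a set of letters contains a step that leaves it. -/
theorem exists_crossing {α : Type*} {r : α → α → Prop} {p : α → Prop} {a b : α}
    (h : ReflTransGen r a b) (ha : p a) (hb : ¬ p b) :
    ∃ c d, ReflTransGen r a c ∧ r c d ∧ ReflTransGen r d b ∧ p c ∧ ¬ p d := by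
  induction h using ReflTransGen.head_induction_on with
  | refl => exact absurd ha hb
  | @head a c hac hcb ih =>
    by_cases hc : p c
    · obtain ⟨c', d, h₁, h₂, h₃⟩ := ih hc
      exact ⟨c', d, .head hac h₁, h₂, h₃⟩
    · exact ⟨a, c, .refl, hac, hcb, ha, hc⟩

/-- A ghost letter (one that ends in a row) is not linked to a real letter (one that begins in a
row) through special nodes. -/
theorem not_link_of_special {a b : N × N} (h : S.Link a b) (ra : S.row a.2) (rb : S.row b.1)
    (ha : S.Special a.2) (hb : S.Special b.1) : False :=
  h.2.2.2 ⟨eq_of_special_of_row ha hb ra rb h.2.2.1, ha⟩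

theorem valid_of_reflTransGen {a b : N × N} (h : ReflTransGen S.Link a b)
    (ha : a.2 ∈ S.nbr a.1) : b.2 ∈ S.nbr b.1 := by
  induction h with
  | refl => exact ha
  | tail _ h _ => exact h.2.1

theorem valid_of_transGen_self {a : N × N} (h : TransGen S.Link a a) : a.2 ∈ S.nbr a.1 := by
  obtain ⟨_, h, _⟩ := TransGen.head'_iff.1 h
  exact h.1

/-! ### Branching and recurrent letters -/

variable (S) in
/-- A path that starts in a nonspecial node can enter a closed path only by its own last letter:
otherwise there would be infinitely many reduced words none of which is a suffix of another. -/
def NoBranch : Prop :=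
  ∀ ⦃a l b b' : N × N⦄, ¬ S.Special a.1 → ReflTransGen S.Link a l → S.Link l b →
    ReflTransGen S.Link b b' → S.Link b' b → l = b'

variable (S) in
/-- There is no closed path from a nonspecial node all of whose letters are the only ones that begin
in their first nodes: such a path is a one-sided inverse. -/
def NoIsometry : Prop :=
  ∀ ⦃a : N × N⦄, ¬ S.Special a.1 → TransGen S.Link a a →
    (∀ z, ReflTransGen S.Link a z → ∀ t ∈ S.nbr z.1, t = z.2) → False

/-- The case of `NoBranch.special` where the path begins in a row. -/
theorem NoBranch.special_of_row (hA : S.NoBranch) {a b : N × N} (h : ReflTransGen S.Link a b)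
    (va : a.2 ∈ S.nbr a.1) (ra : S.row a.1) (ha : ¬ S.Special a.1) : S.Special b.2 := by
  by_contra hb
  have vb := valid_of_reflTransGen h va
  -- the word `w` from `a` to `b` gives the closed path `w w*`; entering it through the special
  -- node in the block of `a.1` is a branching
  have h₁ : TransGen S.Link a a.swap :=
    TransGen.trans_left (TransGen.tail' h (link_swap_self vb hb)) (reflTransGen_swap h)
  have hm : S.sp a.2 = S.sp (S.sp a.1) :=
    S.sp_eq (S.mem_symm va) (S.mem_symm (S.sp_mem a.1))
  have h₂ : TransGen S.Link a (a.2, S.sp a.2) := transGen_congr_right h₁ (S.sp_mem _)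
  have hne : S.sp a.2 ≠ a.1 := fun h' => ha (hm.symm.trans h')
  have h₃ : S.Link (a.2, S.sp a.2) a :=
    ⟨S.sp_mem _, va, by simpa [hm] using S.vtx_sp_sp ra, fun h' => hne h'.1⟩
  have := hA ha h₂.to_reflTransGen h₃ h₁.to_reflTransGen (swap_link_self va ha)
  exact hne (congrArg Prod.snd this)

/-- No path of links leads from a nonspecial node to a nonspecial node. -/
theorem NoBranch.special (hA : S.NoBranch) {a b : N × N} (h : ReflTransGen S.Link a b)
    (va : a.2 ∈ S.nbr a.1) (ha : ¬ S.Special a.1) : S.Special b.2 := by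
  by_contra hb
  have vb := valid_of_reflTransGen h va
  by_cases ra : S.row a.1
  · exact hb (hA.special_of_row h va ra ha)
  by_cases rb : S.row b.2
  · exact ha (hA.special_of_row (reflTransGen_swap h) (S.mem_symm vb) rb hb)
  -- the path begins with a ghost letter and ends with a real one
  obtain ⟨c, d, hac, hcd, hdb, hc, hd⟩ := exists_crossing (p := fun z => ¬ S.row z.1) h ra
    (fun h' => rb ((S.row_iff vb).2 h'))
  rw [not_not] at hd
  have vc := hcd.1
  have rc := (S.row_iff vc).2 hc
  refine not_link_of_special hcd rc hd ?_ ?_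
  · by_contra hs
    exact ha (hA.special_of_row (reflTransGen_swap hac) (S.mem_symm vc) rc hs)
  · by_contra hs
    exact hb (hA.special_of_row hdb hcd.2.1 hd hs)

/-- The letters on a path from a nonspecial node have no rivals: exchanging the last node of such a
letter for another one would lead to a nonspecial node. -/
theorem NoBranch.eq_of_mem_nbr (hA : S.NoBranch) {a z : N × N} (h : ReflTransGen S.Link a z)
    (va : a.2 ∈ S.nbr a.1) (ha : ¬ S.Special a.1) {t : N} (ht : t ∈ S.nbr z.1) : t = z.2 := by
  have hz := hA.special h va ha
  have hs : S.Special t := by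
    rcases reflTransGen_iff_eq_or_transGen.1 h with rfl | h
    · exact hA.special (a := (z.1, t)) .refl ht ha
    · exact hA.special (transGen_congr_right (x := z.1) (t := z.2) h ht).to_reflTransGen va ha
  rw [eq_sp_of_special ht hs, ← eq_sp_of_special (valid_of_reflTransGen h va) hz]

variable (S) in
/-- A letter is recurrent if it lies on a closed path of links. -/
def Recurrent (a : N × N) : Prop := TransGen S.Link a a

theorem Recurrent.swap {a : N × N} (h : S.Recurrent a) : S.Recurrent a.swap :=
  transGen_swap h

theorem Recurrent.special_left (hA : S.NoBranch) (hB : S.NoIsometry) {a : N × N}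
    (h : S.Recurrent a) : S.Special a.1 := by
  by_contra ha
  exact hB ha h fun z hz t ht => hA.eq_of_mem_nbr hz (valid_of_transGen_self h) ha ht

theorem Recurrent.special_right (hA : S.NoBranch) (hB : S.NoIsometry) {a : N × N}
    (h : S.Recurrent a) : S.Special a.2 :=
  h.swap.special_left hA hB

/-- No path leads from a nonspecial node to a recurrent letter, since it would enter a closed path
through a letter that is not recurrent. -/
theorem special_of_reflTransGen_recurrent (hA : S.NoBranch) (hB : S.NoIsometry) {a b : N × N}
    (hab : ReflTransGen S.Link a b) (hb : S.Recurrent b) : S.Special a.1 := by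
  by_contra ha
  suffices ¬ S.Recurrent b from this hb
  clear hb
  induction hab with
  | refl => exact fun h => ha (h.special_left hA hB)
  | @tail z b haz hzb ih =>
    intro hb
    obtain ⟨b', hbb', hb'⟩ := TransGen.tail'_iff.1 hb
    obtain rfl := hA ha haz hzb hbb' hb'
    exact ih (.head' hb' hbb')

theorem special_of_recurrent_reflTransGen (hA : S.NoBranch) (hB : S.NoIsometry) {a b : N × N}
    (hab : ReflTransGen S.Link a b) (ha : S.Recurrent a) : S.Special b.2 :=
  special_of_reflTransGen_recurrent hA hB (reflTransGen_swap hab) ha.swap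

/-- Between recurrent letters, a ghost letter is followed by ghost letters only. -/
theorem row_of_link (hA : S.NoBranch) (hB : S.NoIsometry) {a b y z : N × N} (ha : S.Recurrent a)
    (hb : S.Recurrent b) (hay : ReflTransGen S.Link a y) (hyz : S.Link y z)
    (hzb : ReflTransGen S.Link z b) (hz : S.row z.1) : S.row y.1 := by
  by_contra hy
  exact not_link_of_special hyz ((S.row_iff hyz.1).2 hy) hz
    (special_of_recurrent_reflTransGen hA hB hay ha)
    (special_of_reflTransGen_recurrent hA hB hzb hb)

theorem row_of_reflTransGen (hA : S.NoBranch) (hB : S.NoIsometry) {a b y z : N × N}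
    (ha : S.Recurrent a) (hb : S.Recurrent b) (hay : ReflTransGen S.Link a y)
    (hyz : ReflTransGen S.Link y z) (hzb : ReflTransGen S.Link z b) (hz : S.row z.1) :
    S.row y.1 := by
  induction hyz using ReflTransGen.head_induction_on with
  | refl => exact hz
  | head hyc hcz ih =>
    exact row_of_link hA hB ha hb hay hyc (hcz.trans hzb) (ih (hay.tail hyc))

/-- A recurrent real letter is followed by a recurrent real letter. -/
theorem Recurrent.exists_link (hA : S.NoBranch) (hB : S.NoIsometry) {a : N × N}
    (ha : S.Recurrent a) (ra : S.row a.1) :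
    ∃ m, S.Link a m ∧ ReflTransGen S.Link m a ∧ S.Recurrent m ∧ S.row m.1 := by
  obtain ⟨m, ham, hma⟩ := TransGen.head'_iff.1 ha
  exact ⟨m, ham, hma, .tail' hma ham, row_of_reflTransGen hA hB ha ha (.single ham) hma .refl ra⟩

theorem eq_of_link_of_special {a b c : N × N} (hb : S.Link a b) (hc : S.Link a c)
    (rb : S.row b.1) (rc : S.row c.1) (sb : S.Special b.1) (sc : S.Special c.1)
    (sb' : S.Special b.2) (sc' : S.Special c.2) : b = c := by
  have h : b.1 = c.1 := eq_of_special_of_row sb sc rb rc (hb.2.2.1.symm.trans hc.2.2.1)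
  refine Prod.ext h ?_
  rw [eq_sp_of_special hb.2.1 sb', eq_sp_of_special hc.2.1 sc', h]

/-- Real letters between a recurrent real letter and a recurrent letter are recurrent: closed paths
of real letters have no exits. -/
theorem recurrent_of_between (hA : S.NoBranch) (hB : S.NoIsometry) {a b z : N × N}
    (ha : S.Recurrent a) (hb : S.Recurrent b) (haz : ReflTransGen S.Link a z)
    (hzb : ReflTransGen S.Link z b) (hz : S.row z.1) : S.Recurrent z := by
  induction haz with
  | refl => exact ha
  | @tail y z hay hyz ih =>
    have ry := row_of_link hA hB ha hb hay hyz hzb hz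
    have hy := ih (.head hyz hzb) ry
    obtain ⟨m, hym, -, hm, rm⟩ := hy.exists_link hA hB ry
    have := eq_of_link_of_special hyz hym hz rm (special_of_reflTransGen_recurrent hA hB hzb hb)
      (hm.special_left hA hB) (special_of_recurrent_reflTransGen hA hB (hay.tail hyz) ha)
      (hm.special_right hA hB)
    exact this ▸ hm

open Classical in
/-- Two recurrent real letters that are linked to the same recurrent real letter agree, since the
successor map is injective on its periodic points. -/
theorem Recurrent.eq_of_link (hA : S.NoBranch) (hB : S.NoIsometry) {a b m : N × N}
    (ha : S.Recurrent a) (hb : S.Recurrent b) (ra : S.row a.1) (rb : S.row b.1)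
    (hm : S.Recurrent m) (rm : S.row m.1) (ham : S.Link a m) (hbm : S.Link b m) : a = b := by
  let f : N × N → N × N := fun z =>
    if h : ∃ y, S.Link z y ∧ S.Recurrent y ∧ S.row y.1 then h.choose else z
  have hf : ∀ {z y}, S.Link z y → S.Recurrent y → S.row y.1 → f z = y := by
    intro z y hzy hy ry
    have h : ∃ y, S.Link z y ∧ S.Recurrent y ∧ S.row y.1 := ⟨y, hzy, hy, ry⟩
    have hs := h.choose_spec
    simp only [f, dif_pos h]
    exact eq_of_link_of_special hs.1 hzy hs.2.2 ry (hs.2.1.special_left hA hB)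
      (hy.special_left hA hB) (hs.2.1.special_right hA hB) (hy.special_right hA hB)
  have hper : ∀ {z}, S.Recurrent z → S.row z.1 → z ∈ Function.periodicPts f := by
    intro z hz rz
    have key : ∀ y, TransGen S.Link z y → ReflTransGen S.Link y z →
        ∃ n, 0 < n ∧ f^[n] z = y := by
      intro y hzy
      induction hzy with
      | @single y hzy =>
        intro hyz
        exact ⟨1, one_pos, hf hzy (.tail' hyz hzy)
          (row_of_reflTransGen hA hB hz hz (.single hzy) hyz .refl rz)⟩
      | @tail x y hzx hxy ih =>
        intro hyz
        obtain ⟨n, -, hn⟩ := ih (.head hxy hyz)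
        refine ⟨n + 1, n.succ_pos, ?_⟩
        rw [Function.iterate_succ_apply', hn]
        exact hf hxy (.tail' (hyz.trans hzx.to_reflTransGen) hxy)
          (row_of_reflTransGen hA hB hz hz (hzx.to_reflTransGen.tail hxy) hyz .refl rz)
    obtain ⟨n, hn, h⟩ := key z hz .refl
    exact ⟨n, hn, h⟩
  exact (Function.bijOn_periodicPts f).injOn (hper ha ra) (hper hb rb)
    ((hf ham hm rm).trans (hf hbm hm rm).symm)

/-- Linked recurrent letters are of the same kind. -/
theorem Recurrent.row_iff_of_reflTransGen (hA : S.NoBranch) (hB : S.NoIsometry) {a b : N × N}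
    (ha : S.Recurrent a) (hb : S.Recurrent b) (hab : ReflTransGen S.Link a b) :
    S.row a.1 ↔ S.row b.1 := by
  refine ⟨fun ra => ?_, row_of_reflTransGen hA hB ha hb .refl hab .refl⟩
  by_contra rb
  obtain ⟨p, q, hap, hpq, hqb, rp, rq⟩ := exists_crossing (p := fun z => S.row z.1) hab ra rb
  have row_swap : ∀ {z : N × N}, z.2 ∈ S.nbr z.1 → ¬ S.row z.1 → S.row z.swap.1 :=
    fun hz h => (S.row_iff hz).2 h
  have hp : S.Recurrent p := recurrent_of_between hA hB ha hb hap (.head hpq hqb) rp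
  have rq' := row_swap hpq.2.1 rq
  have hq : S.Recurrent q.swap := recurrent_of_between hA hB hb.swap ha.swap
    (reflTransGen_swap hqb) (reflTransGen_swap (hap.tail hpq)) rq'
  obtain ⟨m, hpm, -, hm, rm⟩ := hp.exists_link hA hB rp
  obtain ⟨m', hqm', -, hm', rm'⟩ := hq.exists_link hA hB rq'
  have hmm : m.1 = m'.1 := eq_of_special_of_row (hm.special_left hA hB) (hm'.special_left hA hB)
    rm rm' (by rw [← hpm.2.2.1, ← hqm'.2.2.1]; exact hpq.2.2.1)
  have hmm' : m' = m := Prod.ext hmm.symm (by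
    rw [eq_sp_of_special hpm.2.1 (hm.special_right hA hB),
      eq_sp_of_special hqm'.2.1 (hm'.special_right hA hB), hmm])
  have := hp.eq_of_link hA hB hq rp rq' hm rm hpm (hmm' ▸ hqm')
  exact hpq.2.2.2 ⟨congrArg Prod.snd this, hp.special_right hA hB⟩

/-! ### Counting reduced words -/

open Classical in
variable (S) in
/-- The height of a letter: `1` for a real letter and `-1` for a ghost letter. -/
noncomputable def height (a : N × N) : ℤ := if S.row a.1 then 1 else -1

open Classical in
theorem length_filter_le_card [Fintype N] {l : List (N × N)} (hl : l.IsChain S.Link)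
    {p : N × N → Prop} (hp : ∀ a ∈ l, p a → ¬ S.Recurrent a) :
    (l.filter fun a => p a).length ≤ Fintype.card (N × N) := by
  refine List.Nodup.length_le_card ?_
  have h : l.Pairwise (TransGen S.Link) :=
    List.isChain_iff_pairwise.1 (hl.imp fun _ _ h => TransGen.single h)
  refine (List.pairwise_filter.2 ?_)
  refine h.imp_of_mem ?_
  rintro a b ha - hab pa - rfl
  exact hp a ha (by simpa using pa) hab

open Classical in
theorem sum_height (l : List (N × N)) :
    (l.map S.height).sum = ((l.filter fun a => S.row a.1).length : ℤ)
      - (l.filter fun a => ¬ S.row a.1).length := by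
  induction l with
  | nil => simp
  | cons a l ih =>
    by_cases h : S.row a.1 <;> simp [height, h, ih] <;> ring

open Classical in
theorem length_eq_add (l : List (N × N)) :
    l.length = (l.filter fun a => S.row a.1).length + (l.filter fun a => ¬ S.row a.1).length := by
  induction l with
  | nil => simp
  | cons a l ih =>
    by_cases h : S.row a.1 <;> simp [h, ih] <;> ring

/-- In a reduced word, the recurrent letters are all real or all ghost, and other letters occur only
once; hence the length is bounded in terms of the height. -/
theorem length_le_of_isChain (hA : S.NoBranch) (hB : S.NoIsometry) [Fintype N] {l : List (N × N)}
    (hl : l.IsChain S.Link) :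
    l.length ≤ (l.map S.height).sum.natAbs + 2 * Fintype.card (N × N) := by
  classical
  have h : l.Pairwise fun a b => TransGen S.Link a b ∨ TransGen S.Link b a :=
    (List.isChain_iff_pairwise.1 (hl.imp fun _ _ h => TransGen.single h)).imp Or.inl
  have h₁ := sum_height (S := S) l
  have h₂ := length_eq_add (S := S) l
  by_cases hr : ∀ a ∈ l, S.row a.1 → ¬ S.Recurrent a
  · have := length_filter_le_card hl hr
    omega
  by_cases hg : ∀ a ∈ l, ¬ S.row a.1 → ¬ S.Recurrent a
  · have : (l.filter fun a => ¬ S.row a.1).length ≤ Fintype.card (N × N) := by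
      convert length_filter_le_card hl hg
    omega
  push Not at hr hg
  obtain ⟨a, ha, ra, hra⟩ := hr
  obtain ⟨b, hb, rb, hrb⟩ := hg
  exfalso
  have hab : a ≠ b := fun hab => rb (hab ▸ ra)
  have : Std.Symm fun a b => TransGen S.Link a b ∨ TransGen S.Link b a := ⟨fun _ _ h => h.symm⟩
  rcases h.forall ha hb hab with h | h
  · exact rb ((hra.row_iff_of_reflTransGen hA hB hrb h.to_reflTransGen).1 ra)
  · exact rb ((hrb.row_iff_of_reflTransGen hA hB hra h.to_reflTransGen).2 ra)

theorem finite_setOf_isChain (hA : S.NoBranch) (hB : S.NoIsometry) [Finite N] (k : ℤ) :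
    {l : List (N × N) | l.IsChain S.Link ∧ (l.map S.height).sum = k}.Finite := by
  have := Fintype.ofFinite N
  refine (List.finite_length_le (N × N) (k.natAbs + 2 * Fintype.card (N × N))).subset ?_
  rintro l ⟨hl, rfl⟩
  exact length_le_of_isChain hA hB hl

end NodeSystem

/-! ### Representations and reduced words -/

namespace NodeSystem

open scoped Classical in
/-- Elements `P v` and `X x t` of a ring satisfying the relations of a weighted Leavitt path
algebra, written uniformly in rows and columns: the matrices with entries `X x t` (`x` a row, `t` a
column) and `X t x` are inverse to each other. -/
structure IsRep {V N : Type*} (S : NodeSystem V N) {B : Type*} [NonUnitalRing B] (P : V → B)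
    (X : N → N → B) : Prop where
  vertex_mul : ∀ u v, P u * P v = if u = v then P u else 0
  vertex_mul_letter : ∀ x t, P (S.vtx x) * X x t = X x t
  letter_mul_vertex : ∀ x t, X x t * P (S.vtx t) = X x t
  eq_zero : ∀ x t, t ∉ S.nbr x → X x t = 0
  sum_mul : ∀ x y, S.sp x = S.sp y →
    ∑ t ∈ S.nbr x, X x t * X t y = if x = y then P (S.vtx x) else 0

variable {V N : Type*} (S : NodeSystem V N)

/-- The vertex at which a word begins; the second argument is the vertex at which it ends. -/
def start : List (N × N) → V → V
  | [], v => v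
  | a :: _, _ => S.vtx a.1

/-- The letter `(x, t)` meets the first letter of `l` in the special node `t`. -/
def Blocked (t : N) (l : List (N × N)) : Prop := S.Special t ∧ ∃ y l', l = (t, y) :: l'

/-- The word `l` is reduced and ends at the vertex `v`. -/
def Reduced : List (N × N) → V → Prop
  | [], _ => True
  | a :: l, v => a.2 ∈ S.nbr a.1 ∧ S.vtx a.2 = S.start l v ∧ ¬ S.Blocked a.2 l ∧ Reduced l v

variable {S}

theorem reduced_cons {a : N × N} {l : List (N × N)} {v : V} : S.Reduced (a :: l) v ↔
    a.2 ∈ S.nbr a.1 ∧ S.vtx a.2 = S.start l v ∧ ¬ S.Blocked a.2 l ∧ S.Reduced l v := Iff.rfl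

theorem blocked_cons {t : N} {a : N × N} {l : List (N × N)} :
    S.Blocked t (a :: l) ↔ S.Special t ∧ a.1 = t := by
  refine and_congr_right fun _ => ⟨?_, ?_⟩
  · rintro ⟨y, l', h⟩
    rw [(List.cons.inj h).1]
  · rintro rfl
    exact ⟨a.2, l, rfl⟩

theorem not_blocked_nil {t : N} : ¬ S.Blocked t [] := fun ⟨_, _, _, h⟩ => by cases h

theorem reduced_cons_cons {a b : N × N} {l : List (N × N)} {v : V} :
    S.Reduced (a :: b :: l) v ↔ S.Link a b ∧ S.Reduced (b :: l) v := by
  rw [reduced_cons, blocked_cons, Link]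
  constructor
  · rintro ⟨h₁, h₂, h₃, h₄⟩
    exact ⟨⟨h₁, h₄.1, h₂, fun h => h₃ ⟨h.2, h.1.symm⟩⟩, h₄⟩
  · rintro ⟨⟨h₁, h₄, h₂, h₃⟩, h₅⟩
    exact ⟨h₁, h₂, fun h => h₃ ⟨h.2.symm, h.1⟩, h₅⟩

theorem reduced_singleton {a : N × N} {v : V} :
    S.Reduced [a] v ↔ a.2 ∈ S.nbr a.1 ∧ S.vtx a.2 = v := by
  simp [not_blocked_nil, Reduced, start]

theorem Reduced.isChain {l : List (N × N)} {v : V} (h : S.Reduced l v) : l.IsChain S.Link := by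
  induction l with
  | nil => exact .nil
  | cons a l ih =>
    cases l with
    | nil => exact .singleton a
    | cons b l => exact .cons_cons (reduced_cons_cons.1 h).1 (ih (reduced_cons_cons.1 h).2)

theorem reduced_append_singleton {l : List (N × N)} {a : N × N} (ha : a.2 ∈ S.nbr a.1)
    (h : (l ++ [a]).IsChain S.Link) : S.Reduced (l ++ [a]) (S.vtx a.2) := by
  induction l with
  | nil => exact reduced_singleton.2 ⟨ha, rfl⟩
  | cons b l ih =>
    cases l with
    | nil =>
      exact reduced_cons_cons.2 ⟨(List.isChain_cons_cons.1 h).1, ih (List.isChain_cons_cons.1 h).2⟩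
    | cons c l =>
      exact reduced_cons_cons.2 ⟨(List.isChain_cons_cons.1 h).1, ih (List.isChain_cons_cons.1 h).2⟩

theorem reduced_append_cons {l l' : List (N × N)} {a b : N × N} {v : V}
    (h : (l ++ [a]).IsChain S.Link) (hab : S.Link a b) (h' : S.Reduced (b :: l') v) :
    S.Reduced (l ++ [a] ++ b :: l') v := by
  induction l with
  | nil => exact reduced_cons_cons.2 ⟨hab, h'⟩
  | cons c l ih =>
    cases l with
    | nil =>
      exact reduced_cons_cons.2 ⟨(List.isChain_cons_cons.1 h).1, ih (List.isChain_cons_cons.1 h).2⟩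
    | cons d l =>
      exact reduced_cons_cons.2 ⟨(List.isChain_cons_cons.1 h).1, ih (List.isChain_cons_cons.1 h).2⟩

/-! ### Products of letters -/

section Rep

variable {B : Type*} [NonUnitalRing B] {P : V → B} {X : N → N → B}

/-- The product of the letters of a word that ends at the vertex `v`. -/
def wordProd (P : V → B) (X : N → N → B) (l : List (N × N)) (v : V) : B :=
  l.foldr (fun a z => X a.1 a.2 * z) (P v)

theorem wordProd_cons (a : N × N) (l : List (N × N)) (v : V) :
    wordProd P X (a :: l) v = X a.1 a.2 * wordProd P X l v := rfl

theorem IsRep.vertex_mul_self (h : S.IsRep P X) (v : V) : P v * P v = P v := by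
  simp [h.vertex_mul]

theorem IsRep.vertex_mul_wordProd (h : S.IsRep P X) (l : List (N × N)) (v : V) :
    P (S.start l v) * wordProd P X l v = wordProd P X l v := by
  cases l with
  | nil => exact h.vertex_mul_self v
  | cons a l => rw [wordProd_cons, ← mul_assoc, start, h.vertex_mul_letter]

theorem IsRep.wordProd_mul_vertex (h : S.IsRep P X) (l : List (N × N)) (v : V) :
    wordProd P X l v * P v = wordProd P X l v := by
  induction l with
  | nil => exact h.vertex_mul_self v
  | cons a l ih => rw [wordProd_cons, mul_assoc, ih]

theorem IsRep.wordProd_append (h : S.IsRep P X) (l l' : List (N × N)) (v : V) :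
    wordProd P X (l ++ l') v = wordProd P X l (S.start l' v) * wordProd P X l' v := by
  induction l with
  | nil => exact (h.vertex_mul_wordProd l' v).symm
  | cons a l ih => rw [List.cons_append, wordProd_cons, ih, wordProd_cons, mul_assoc]

theorem IsRep.vertex_mul_wordProd_of_ne (h : S.IsRep P X) {l : List (N × N)} {u v : V}
    (hu : u ≠ S.start l v) : P u * wordProd P X l v = 0 := by
  rw [← h.vertex_mul_wordProd, ← mul_assoc, h.vertex_mul, if_neg hu, zero_mul]

theorem IsRep.letter_mul_wordProd_of_ne (h : S.IsRep P X) {l : List (N × N)} {x t : N} {v : V}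
    (hu : S.vtx t ≠ S.start l v) : X x t * wordProd P X l v = 0 := by
  rw [← h.letter_mul_vertex, mul_assoc, h.vertex_mul_wordProd_of_ne hu, mul_zero]

/-- The word of the adjoint letters, in the opposite order. -/
def starWord (l : List (N × N)) : List (N × N) := (l.map Prod.swap).reverse

theorem starWord_cons (a : N × N) (l : List (N × N)) :
    starWord (a :: l) = starWord l ++ [a.swap] := by
  simp [starWord]

/-- If each letter of a reduced word is the only one that begins in its first node, then the word
is a left inverse of its adjoint. -/
theorem IsRep.wordProd_mul_starWord (h : S.IsRep P X) {l : List (N × N)} {v : V}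
    (hl : S.Reduced l v) (hu : ∀ z ∈ l, ∀ t ∈ S.nbr z.1, t = z.2) :
    wordProd P X l v * wordProd P X (starWord l) (S.start l v) = P (S.start l v) := by
  induction l with
  | nil => exact h.vertex_mul_self v
  | cons a l ih =>
    obtain ⟨ha, hv, -, hl⟩ := reduced_cons.1 hl
    have h₁ := ih hl fun z hz => hu z (List.mem_cons_of_mem a hz)
    have h₂ : X a.1 a.2 * X a.2 a.1 = P (S.vtx a.1) := by
      have := h.sum_mul a.1 a.1 rfl
      rw [if_pos rfl, Finset.sum_eq_single_of_mem a.2 ha] at this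
      · exact this
      · intro t ht hne
        exact absurd (hu a List.mem_cons_self t ht) hne
    rw [starWord_cons, h.wordProd_append, wordProd_cons,
      show S.start [a.swap] (S.start (a :: l) v) = S.start l v from hv]
    calc X a.1 a.2 * wordProd P X l v * (wordProd P X (starWord l) (S.start l v) *
          wordProd P X [a.swap] (S.start (a :: l) v))
        = X a.1 a.2 * (wordProd P X l v * wordProd P X (starWord l) (S.start l v)) *
          (X a.2 a.1 * P (S.vtx a.1)) := by simp only [mul_assoc]; rfl
      _ = P (S.vtx a.1) := by
        rw [h₁, ← hv, h.letter_mul_vertex, ← mul_assoc, h₂, h.vertex_mul_self]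

end Rep

/-! ### The module of reduced words -/

section Words

variable (K : Type*) [Field K]

variable (S) in
open scoped Classical in
/-- The product of the letter `(x, t)` and a word `l` ending at the vertex `v`, as a combination of
reduced words; words `l` that are not reduced are sent to zero. -/
noncomputable def letterAux (x t : N) (l : List (N × N)) (v : V) : (List (N × N) × V) →₀ K :=
  if t ∈ S.nbr x ∧ S.vtx t = S.start l v ∧ S.Reduced l v then
    match l with
    | [] => Finsupp.single ([(x, t)], v) 1
    | b :: l' =>
      if S.Special t ∧ b.1 = t then
        (if x = b.2 then Finsupp.single (l', v) 1 else 0) -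
          ∑ u ∈ S.nbr x, if u ∈ S.nbr b.2 ∧ u ≠ t then
            Finsupp.single ((x, u) :: (u, b.2) :: l', v) 1 else 0
      else Finsupp.single ((x, t) :: b :: l', v) 1
  else 0

variable (S) in
/-- The action of the letter `(x, t)` on the space with basis the words. -/
noncomputable def letterOp (x t : N) : Module.End K ((List (N × N) × V) →₀ K) :=
  Finsupp.linearCombination K fun p => S.letterAux K x t p.1 p.2

variable (S) in
open scoped Classical in
/-- The action of a vertex on the space with basis the words. -/
noncomputable def vertexOp (v : V) : Module.End K ((List (N × N) × V) →₀ K) :=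
  Finsupp.linearCombination K fun p =>
    if S.start p.1 p.2 = v ∧ S.Reduced p.1 p.2 then Finsupp.single p 1 else 0

variable {K}

theorem letterOp_single (x t : N) (l : List (N × N)) (v : V) :
    S.letterOp K x t (Finsupp.single (l, v) 1) = S.letterAux K x t l v := by
  simp [letterOp]

open scoped Classical in
theorem vertexOp_single (v w : V) (l : List (N × N)) :
    S.vertexOp K v (Finsupp.single (l, w) 1) =
      if S.start l w = v ∧ S.Reduced l w then Finsupp.single (l, w) 1 else 0 := by
  simp [vertexOp]

theorem letterOp_single_eq_zero {x t : N} {l : List (N × N)} {v : V}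
    (h : ¬ (t ∈ S.nbr x ∧ S.vtx t = S.start l v ∧ S.Reduced l v)) :
    S.letterOp K x t (Finsupp.single (l, v) 1) = 0 := by
  rw [letterOp_single, letterAux.eq_def, if_neg h]

theorem letterOp_single_of_reduced {x t : N} {l : List (N × N)} {v : V}
    (h : S.Reduced ((x, t) :: l) v) :
    S.letterOp K x t (Finsupp.single (l, v) 1) = Finsupp.single ((x, t) :: l, v) 1 := by
  obtain ⟨h₁, h₂, h₃, h₄⟩ := reduced_cons.1 h
  rw [letterOp_single, letterAux.eq_def, if_pos ⟨h₁, h₂, h₄⟩]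
  cases l with
  | nil => rfl
  | cons b l =>
    rw [blocked_cons] at h₃
    exact if_neg h₃

open scoped Classical in
theorem letterOp_single_of_special {x t y : N} {l : List (N × N)} {v : V} (hx : t ∈ S.nbr x)
    (h : S.Reduced ((t, y) :: l) v) (ht : S.Special t) :
    S.letterOp K x t (Finsupp.single ((t, y) :: l, v) 1) =
      (if x = y then Finsupp.single (l, v) 1 else 0) -
        ∑ u ∈ S.nbr x, if u ∈ S.nbr y ∧ u ≠ t then
          Finsupp.single ((x, u) :: (u, y) :: l, v) 1 else 0 := by
  rw [letterOp_single, letterAux.eq_def, if_pos ⟨hx, rfl, h⟩]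
  exact if_pos ⟨ht, rfl⟩

/-- The three possibilities for the product of a letter and a reduced word. -/
theorem letter_cases (x t : N) (l : List (N × N)) (v : V) :
    ¬ (t ∈ S.nbr x ∧ S.vtx t = S.start l v ∧ S.Reduced l v) ∨ S.Reduced ((x, t) :: l) v ∨
      (t ∈ S.nbr x ∧ S.Special t ∧ ∃ y l', l = (t, y) :: l' ∧ S.Reduced ((t, y) :: l') v) := by
  by_cases h : t ∈ S.nbr x ∧ S.vtx t = S.start l v ∧ S.Reduced l v
  · by_cases hb : S.Blocked t l
    · obtain ⟨ht, y, l', rfl⟩ := hb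
      exact Or.inr (Or.inr ⟨h.1, ht, y, l', rfl, h.2.2⟩)
    · exact Or.inr (Or.inl (reduced_cons.2 ⟨h.1, h.2.1, hb, h.2.2⟩))
  · exact Or.inl h

/-- The words that arise from resolving a meeting in a special node are reduced. -/
theorem reduced_of_special {x t y u : N} {l : List (N × N)} {v : V} (hx : t ∈ S.nbr x)
    (h : S.Reduced ((t, y) :: l) v) (ht : S.Special t) (hux : u ∈ S.nbr x) (huy : u ∈ S.nbr y)
    (hu : u ≠ t) : S.Reduced ((x, u) :: (u, y) :: l) v := by
  obtain ⟨-, h₂, h₃, h₄⟩ := reduced_cons.1 h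
  refine reduced_cons_cons.2 ⟨⟨hux, S.mem_symm huy, rfl, fun h' => hu ?_⟩,
    reduced_cons.2 ⟨S.mem_symm huy, h₂, h₃, h₄⟩⟩
  rw [eq_sp_of_special hux h'.2, eq_sp_of_special hx ht]

open scoped Classical in
/-- The relations hold on a reduced word that does not begin in the special node `y`. -/
theorem sum_letterOp_of_not_blocked {x y : N} (hxy : S.sp x = S.sp y) {l : List (N × N)} {v : V}
    (hl : S.Reduced l v) (hv : S.vtx y = S.start l v) (hb : ¬ S.Blocked y l) :
    ∑ t ∈ S.nbr x, S.letterOp K x t (S.letterOp K t y (Finsupp.single (l, v) 1)) =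
      if x = y then Finsupp.single (l, v) 1 else 0 := by
  have hr : ∀ {t}, t ∈ S.nbr y → S.Reduced ((t, y) :: l) v := fun ht =>
    reduced_cons.2 ⟨S.mem_symm ht, hv, hb, hl⟩
  have key : ∀ t ∈ S.nbr x, S.letterOp K x t (S.letterOp K t y (Finsupp.single (l, v) 1)) =
      (if t ∈ S.nbr y ∧ t ≠ S.sp x then Finsupp.single ((x, t) :: (t, y) :: l, v) 1 else 0) +
      if t = S.sp x then (if x = y then Finsupp.single (l, v) 1 else 0) -
        (∑ u ∈ S.nbr x, if u ∈ S.nbr y ∧ u ≠ S.sp x then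
          Finsupp.single ((x, u) :: (u, y) :: l, v) (1 : K) else 0) else 0 := by
    intro t ht
    by_cases hty : t ∈ S.nbr y
    · rw [letterOp_single_of_reduced (hr hty)]
      by_cases h : t = S.sp x
      · subst h
        rw [letterOp_single_of_special ht (hr hty) (special_sp x)]
        simp
      · rw [letterOp_single_of_reduced (reduced_of_special (S.sp_mem x)
          (hr (hxy ▸ S.sp_mem y)) (special_sp x) ht hty h)]
        simp [h, hty]
    · have h : t ≠ S.sp x := fun h => hty (h ▸ hxy ▸ S.sp_mem y)
      rw [letterOp_single_eq_zero fun h => hty (S.mem_symm h.1)]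
      simp [h, hty]
  rw [Finset.sum_congr rfl key, Finset.sum_add_distrib, Finset.sum_ite_eq', if_pos (S.sp_mem x)]
  abel

open scoped Classical in
/-- The relations hold on a reduced word that begins in the special node `y`; after the first letter
has been resolved, `sum_letterOp_of_not_blocked` applies. -/
theorem sum_letterOp_of_blocked {x y z : N} (hxy : S.sp x = S.sp y) {l : List (N × N)} {v : V}
    (hl : S.Reduced ((y, z) :: l) v) (hy : S.Special y) :
    ∑ t ∈ S.nbr x, S.letterOp K x t (S.letterOp K t y (Finsupp.single ((y, z) :: l, v) 1)) =
      if x = y then Finsupp.single ((y, z) :: l, v) 1 else 0 := by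
  obtain ⟨hyz, hv, hb, hl'⟩ := reduced_cons.1 hl
  simp only at hyz hv hb
  have hr : ∀ {u}, u ∈ S.nbr z → S.Reduced ((u, z) :: l) v := fun hu =>
    reduced_cons.2 ⟨S.mem_symm hu, hv, hb, hl'⟩
  have hzy := S.mem_symm hyz
  have hspec : ∀ {u}, u ∈ S.nbr z → S.Special u → u = y := fun hu hs =>
    (eq_sp_of_special hu hs).trans (eq_sp_of_special hzy hy).symm
  have key : ∀ t ∈ S.nbr x, S.letterOp K t y (Finsupp.single ((y, z) :: l, v) 1) =
      (if t = z then Finsupp.single (l, v) 1 else 0) -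
        ∑ u ∈ (S.nbr z).erase y, S.letterOp K t u (Finsupp.single ((u, z) :: l, v) 1) := by
    intro t ht
    have hty : y ∈ S.nbr t := hy.mem_nbr hxy ht
    rw [letterOp_single_of_special hty hl hy]
    congr 1
    have h₁ : ∀ u ∈ (S.nbr z).erase y, S.letterOp K t u (Finsupp.single ((u, z) :: l, v) 1) =
        if u ∈ S.nbr t then Finsupp.single ((t, u) :: (u, z) :: l, v) 1 else 0 := by
      intro u hu
      obtain ⟨hne, hu⟩ := Finset.mem_erase.1 hu
      by_cases h : u ∈ S.nbr t
      · rw [if_pos h, letterOp_single_of_reduced (reduced_of_special hty hl hy h hu hne)]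
      · rw [if_neg h, letterOp_single_eq_zero fun h' => h h'.1]
    rw [Finset.sum_congr rfl h₁, ← Finset.sum_filter, ← Finset.sum_filter]
    refine Finset.sum_congr ?_ fun _ _ => rfl
    ext u
    simp only [Finset.mem_filter, Finset.mem_erase]
    tauto
  rw [Finset.sum_congr rfl fun t ht => congrArg (S.letterOp K x t) (key t ht)]
  simp only [map_sub, map_sum, Finset.sum_sub_distrib]
  rw [Finset.sum_comm]
  have h₂ : ∀ u ∈ (S.nbr z).erase y,
      ∑ t ∈ S.nbr x, S.letterOp K x t (S.letterOp K t u (Finsupp.single ((u, z) :: l, v) 1)) =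
        if x = u then Finsupp.single ((u, z) :: l, v) 1 else 0 := by
    intro u hu
    obtain ⟨hne, hu⟩ := Finset.mem_erase.1 hu
    refine sum_letterOp_of_not_blocked
      (hxy.trans (S.sp_eq (S.mem_symm hzy) (S.mem_symm hu))) (hr hu) rfl ?_
    rw [blocked_cons]
    exact fun h => hne (hspec hu h.1)
  rw [Finset.sum_congr rfl h₂, Finset.sum_ite_eq]
  have h₃ : ∑ t ∈ S.nbr x, S.letterOp K x t (if t = z then Finsupp.single (l, v) 1 else 0) =
      if x ∈ S.nbr z then Finsupp.single ((x, z) :: l, v) 1 else 0 := by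
    simp only [apply_ite, map_zero]
    rw [Finset.sum_ite_eq']
    by_cases h : x ∈ S.nbr z
    · rw [if_pos h, if_pos (S.mem_symm h), letterOp_single_of_reduced (hr h)]
    · rw [if_neg h, if_neg fun h' => h (S.mem_symm h')]
  rw [h₃]
  by_cases h : x = y
  · subst h
    simp [hzy]
  · simp [h]

/-- To show that a letter sends a word into the span of the words with the property `p`, it suffices
to check the words that arise by concatenation or by resolving a meeting in a special node. -/
theorem letterOp_apply_reduced {x t : N} {l : List (N × N)} {v : V} {p : (List (N × N)) × V → Prop}
    (h₁ : S.Reduced ((x, t) :: l) v → p ((x, t) :: l, v))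
    (h₂ : ∀ y l', l = (t, y) :: l' → t ∈ S.nbr x → S.Special t → S.Reduced ((t, y) :: l') v →
      (x = y → p (l', v)) ∧
        ∀ u ∈ S.nbr x, u ∈ S.nbr y → u ≠ t → p ((x, u) :: (u, y) :: l', v)) :
    S.letterOp K x t (Finsupp.single (l, v) 1) ∈ Finsupp.supported K K {q | p q} := by
  rcases letter_cases (S := S) x t l v with h | h | ⟨hx, ht, y, l', rfl, h⟩
  · rw [letterOp_single_eq_zero h]
    exact zero_mem _
  · rw [letterOp_single_of_reduced h]
    exact Finsupp.single_mem_supported K _ (h₁ h)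
  · obtain ⟨h₃, h₄⟩ := h₂ y l' rfl hx ht h
    rw [letterOp_single_of_special hx h ht]
    refine sub_mem ?_ (sum_mem fun u hu => ?_)
    · split_ifs with hxy
      · exact Finsupp.single_mem_supported K _ (h₃ hxy)
      · exact zero_mem _
    · split_ifs with h'
      · exact Finsupp.single_mem_supported K _ (h₄ u hu h'.1 h'.2)
      · exact zero_mem _

theorem apply_mem_of_mem_supported {α M : Type*} [AddCommGroup M] [Module K M]
    {f : (α →₀ K) →ₗ[K] M} {s : Set α} {W : Submodule K M} (h : ∀ a ∈ s, f (Finsupp.single a 1) ∈ W)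
    {m : α →₀ K} (hm : m ∈ Finsupp.supported K K s) : f m ∈ W := by
  rw [Finsupp.supported_eq_span_single] at hm
  refine (Submodule.span_le (p := W.comap f)).2 ?_ hm
  rintro _ ⟨a, ha, rfl⟩
  exact h a ha

theorem eqOn_supported {α M : Type*} [AddCommGroup M] [Module K M] {f g : (α →₀ K) →ₗ[K] M}
    {s : Set α} (h : ∀ a ∈ s, f (Finsupp.single a 1) = g (Finsupp.single a 1)) {m : α →₀ K}
    (hm : m ∈ Finsupp.supported K K s) : f m = g m := by
  rw [Finsupp.supported_eq_span_single] at hm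
  exact LinearMap.eqOn_span (s := (fun a => Finsupp.single a (1 : K)) '' s)
    (by rintro _ ⟨a, ha, rfl⟩; exact h a ha) hm

theorem vertexOp_apply_of_mem {v : V} {m : (List (N × N) × V) →₀ K}
    (hm : m ∈ Finsupp.supported K K {q | S.start q.1 q.2 = v ∧ S.Reduced q.1 q.2}) :
    S.vertexOp K v m = m :=
  eqOn_supported (g := LinearMap.id) (fun q hq => (vertexOp_single v q.2 q.1).trans (if_pos hq)) hm

variable (K S) in
/-- The words, with the letters and the vertices acting by left multiplication, form a
representation. -/
theorem isRep_op : S.IsRep (S.vertexOp K) (S.letterOp K) where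
  vertex_mul u v := by
    refine Finsupp.lhom_ext' fun ⟨l, w⟩ => LinearMap.ext_ring ?_
    simp only [LinearMap.comp_apply, Finsupp.lsingle_apply, Module.End.mul_apply, vertexOp_single]
    by_cases huv : u = v
    · subst huv
      by_cases h : S.start l w = u ∧ S.Reduced l w <;> simp [h, vertexOp_single]
    · by_cases h : S.start l w = v ∧ S.Reduced l w
      · simp [h, huv, vertexOp_single, Ne.symm huv]
      · simp [h, huv]
  vertex_mul_letter x t := by
    refine Finsupp.lhom_ext' fun ⟨l, w⟩ => LinearMap.ext_ring ?_
    simp only [LinearMap.comp_apply, Finsupp.lsingle_apply, Module.End.mul_apply]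
    have h := letterOp_apply_reduced (K := K) (x := x) (t := t) (l := l) (v := w) (S := S)
      (p := fun q => S.start q.1 q.2 = S.vtx x ∧ S.Reduced q.1 q.2) (fun h => ⟨rfl, h⟩)
      fun y l' _ hx ht h => ⟨fun hxy => by
        subst hxy; exact ⟨(reduced_cons.1 h).2.1.symm, (reduced_cons.1 h).2.2.2⟩,
        fun u hu hy hne => ⟨rfl, reduced_of_special hx h ht hu hy hne⟩⟩
    exact vertexOp_apply_of_mem h
  letter_mul_vertex x t := by
    refine Finsupp.lhom_ext' fun ⟨l, w⟩ => LinearMap.ext_ring ?_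
    simp only [LinearMap.comp_apply, Finsupp.lsingle_apply, Module.End.mul_apply, vertexOp_single]
    by_cases h : S.start l w = S.vtx t ∧ S.Reduced l w
    · rw [if_pos h]
    · rw [if_neg h, map_zero, letterOp_single_eq_zero fun h' => h ⟨h'.2.1.symm, h'.2.2⟩]
  eq_zero x t h := by
    refine Finsupp.lhom_ext' fun ⟨l, w⟩ => LinearMap.ext_ring ?_
    simpa using letterOp_single_eq_zero fun h' => h h'.1
  sum_mul x y hxy := by
    classical
    refine Finsupp.lhom_ext' fun ⟨l, w⟩ => LinearMap.ext_ring ?_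
    simp only [LinearMap.comp_apply, Finsupp.lsingle_apply, LinearMap.sum_apply,
      Module.End.mul_apply]
    by_cases hl : S.vtx y = S.start l w ∧ S.Reduced l w
    · have h : ∑ t ∈ S.nbr x, S.letterOp K x t (S.letterOp K t y (Finsupp.single (l, w) 1)) =
          if x = y then Finsupp.single (l, w) 1 else 0 := by
        by_cases hb : S.Blocked y l
        · obtain ⟨hy, z, l', rfl⟩ := hb
          exact sum_letterOp_of_blocked hxy hl.2 hy
        · exact sum_letterOp_of_not_blocked hxy hl.2 hl.1 hb
      rw [h]
      split_ifs with h'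
      · subst h'
        rw [vertexOp_single, if_pos ⟨hl.1.symm, hl.2⟩]
      · rfl
    · rw [Finset.sum_eq_zero fun t _ => by
        rw [letterOp_single_eq_zero fun h => hl h.2, map_zero]]
      split_ifs with h'
      · subst h'
        rw [vertexOp_single, if_neg fun h => hl ⟨h.1.symm, h.2⟩]
      · rfl

section WordLin

variable {B : Type*} [NonUnitalRing B] [Module K B] {P : V → B} {X : N → N → B}

open scoped Classical in
variable (K S P X) in
/-- The linear map that sends a reduced word to the product of its letters. -/
noncomputable def wordLin : ((List (N × N) × V) →₀ K) →ₗ[K] B :=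
  Finsupp.linearCombination K fun p =>
    if S.Reduced p.1 p.2 then wordProd P X p.1 p.2 else 0

open scoped Classical in
theorem wordLin_single (l : List (N × N)) (v : V) :
    S.wordLin K P X (Finsupp.single (l, v) 1) =
      if S.Reduced l v then wordProd P X l v else 0 := by
  simp [wordLin]

theorem IsRep.wordLin_letterOp [SMulCommClass K B B] (h : S.IsRep P X) (x t : N)
    (m : (List (N × N) × V) →₀ K) :
    S.wordLin K P X (S.letterOp K x t m) = X x t * S.wordLin K P X m := by
  classical
  suffices S.wordLin K P X ∘ₗ S.letterOp K x t = LinearMap.mulLeft K (X x t) ∘ₗ S.wordLin K P X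
    from LinearMap.congr_fun this m
  refine Finsupp.lhom_ext' fun ⟨l, v⟩ => LinearMap.ext_ring ?_
  simp only [LinearMap.comp_apply, Finsupp.lsingle_apply, LinearMap.mulLeft_apply]
  rcases letter_cases (S := S) x t l v with h' | h' | ⟨hx, ht, y, l, rfl, h'⟩
  · rw [letterOp_single_eq_zero h', map_zero, wordLin_single]
    split_ifs with hl
    · by_cases htx : t ∈ S.nbr x
      · rw [h.letter_mul_wordProd_of_ne fun hv => h' ⟨htx, hv, hl⟩]
      · rw [h.eq_zero x t htx, zero_mul]
    · rw [mul_zero]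
  · rw [letterOp_single_of_reduced h', wordLin_single, wordLin_single, if_pos h',
      if_pos (reduced_cons.1 h').2.2.2, wordProd_cons]
  · obtain ⟨hty, hv, -, hl⟩ := reduced_cons.1 h'
    have hsum : ∑ u ∈ S.nbr x, S.wordLin K P X (if u ∈ S.nbr y ∧ u ≠ t then
          Finsupp.single ((x, u) :: (u, y) :: l, v) 1 else 0) =
        (∑ u ∈ (S.nbr x).erase t, X x u * X u y) * wordProd P X l v := by
      rw [Finset.sum_mul, ← Finset.sum_erase_add _ _ hx]
      simp only [ne_eq, not_true_eq_false, and_false, if_false, map_zero, add_zero]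
      refine Finset.sum_congr rfl fun u hu => ?_
      obtain ⟨hne, hu⟩ := Finset.mem_erase.1 hu
      by_cases hy : u ∈ S.nbr y
      · rw [if_pos ⟨hy, hne⟩, wordLin_single, if_pos (reduced_of_special hx h' ht hu hy hne),
          wordProd_cons, wordProd_cons, mul_assoc]
      · rw [if_neg fun h => hy h.1, map_zero, h.eq_zero u y fun h => hy (S.mem_symm h), mul_zero,
          zero_mul]
    rw [letterOp_single_of_special hx h' ht, map_sub, map_sum, hsum, wordLin_single, if_pos h',
      wordProd_cons, ← mul_assoc, sub_eq_iff_eq_add, ← add_mul, add_comm,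
      Finset.sum_erase_add _ _ hx, h.sum_mul x y (S.sp_eq hx (S.mem_symm hty))]
    split_ifs with hxy
    · subst hxy
      rw [wordLin_single, if_pos hl, show S.vtx x = S.start l v from hv, h.vertex_mul_wordProd]
    · rw [map_zero, zero_mul]

theorem IsRep.wordLin_vertexOp [SMulCommClass K B B] (h : S.IsRep P X) (u : V)
    (m : (List (N × N) × V) →₀ K) :
    S.wordLin K P X (S.vertexOp K u m) = P u * S.wordLin K P X m := by
  suffices S.wordLin K P X ∘ₗ S.vertexOp K u = LinearMap.mulLeft K (P u) ∘ₗ S.wordLin K P X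
    from LinearMap.congr_fun this m
  refine Finsupp.lhom_ext' fun ⟨l, v⟩ => LinearMap.ext_ring ?_
  simp only [LinearMap.comp_apply, Finsupp.lsingle_apply, LinearMap.mulLeft_apply, vertexOp_single,
    wordLin_single]
  by_cases hl : S.Reduced l v
  · by_cases hu : S.start l v = u
    · subst hu
      simp [hl, wordLin_single, h.vertex_mul_wordProd]
    · simp [hl, hu, h.vertex_mul_wordProd_of_ne (Ne.symm hu)]
  · simp [hl]

end WordLin

/-! ### The height of a word -/

variable (K S) in
/-- The span of the reduced words of height `k`. -/
def heightSpan (k : ℤ) : Submodule K ((List (N × N) × V) →₀ K) :=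
  Finsupp.supported K K {p | S.Reduced p.1 p.2 ∧ (p.1.map S.height).sum = k}

theorem height_add {x t : N} (y : N) (hx : t ∈ S.nbr x) :
    S.height (x, t) + S.height (t, y) = 0 := by
  have := S.row_iff hx
  by_cases h : S.row x <;> simp [height, h, this]

theorem map_mem_heightSpan {f : Module.End K ((List (N × N) × V) →₀ K)} {j : ℤ}
    (hf : ∀ l v, S.Reduced l v →
      f (Finsupp.single (l, v) 1) ∈ S.heightSpan K ((l.map S.height).sum + j))
    {k : ℤ} {m : (List (N × N) × V) →₀ K} (hm : m ∈ S.heightSpan K k) :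
    f m ∈ S.heightSpan K (k + j) := by
  refine apply_mem_of_mem_supported ?_ hm
  rintro ⟨l, v⟩ ⟨hl, rfl⟩
  exact hf l v hl

theorem letterOp_mem_heightSpan (x t : N) {k : ℤ}
    {m : (List (N × N) × V) →₀ K} (hm : m ∈ S.heightSpan K k) :
    S.letterOp K x t m ∈ S.heightSpan K (k + S.height (x, t)) := by
  refine map_mem_heightSpan (fun l v hl => ?_) hm
  refine letterOp_apply_reduced (fun h => ⟨h, ?_⟩) ?_
  · rw [List.map_cons, List.sum_cons, add_comm]
  · rintro y l' rfl hx ht h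
    have h₁ := height_add y hx
    refine ⟨fun _ => ⟨(reduced_cons.1 h).2.2.2, ?_⟩, fun u hux huy hu =>
      ⟨reduced_of_special hx h ht hux huy hu, ?_⟩⟩
    · rw [List.map_cons, List.sum_cons]
      linarith
    · have h₂ := height_add y hux
      simp only [List.map_cons, List.sum_cons]
      linarith

theorem vertexOp_mem_heightSpan (u : V) {k : ℤ}
    {m : (List (N × N) × V) →₀ K} (hm : m ∈ S.heightSpan K k) :
    S.vertexOp K u m ∈ S.heightSpan K k := by
  have := map_mem_heightSpan (f := S.vertexOp K u) (j := 0) (fun l v hl => ?_) hm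
  · rwa [add_zero] at this
  · rw [vertexOp_single, add_zero]
    split_ifs
    · exact Finsupp.single_mem_supported K _ ⟨hl, rfl⟩
    · exact zero_mem _

end Words

end NodeSystem

/-! ### Noetherian rings -/

/-- In a left Noetherian ring, one-sided inverses are two-sided: the left annihilators of the powers
of `β` form an ascending chain. -/
theorem IsLeftNoetherianRng.mul_eq_of_mul_eq {R : Type*} [NonUnitalRing R]
    (hR : IsLeftNoetherianRng R) {α β v : R} (h : α * β = v) (hv : v * α = α) (hα : α * v = α)
    (hβ : v * β = β) (hβ' : β * v = β) : β * α = v := by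
  let f : AddMonoid.End R := AddMonoidHom.mulRight β
  let g : AddMonoid.End R := AddMonoidHom.mulRight α
  have hf : ∀ a, f a = a * β := fun _ => rfl
  have hg : ∀ a, g a = a * α := fun _ => rfl
  have hfs : ∀ n a, (f ^ (n + 1)) a = f ((f ^ n) a) := fun n a => by rw [pow_succ']; rfl
  have hfs' : ∀ n a, (f ^ (n + 1)) a = (f ^ n) (f a) := fun n a => by rw [pow_succ]; rfl
  have hgs : ∀ n a, (g ^ (n + 1)) a = g ((g ^ n) a) := fun n a => by rw [pow_succ']; rfl
  let I : ℕ →o AddSubgroup R :=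
    { toFun := fun n => AddMonoidHom.ker (f ^ n)
      monotone' := monotone_nat_of_le_succ fun n a ha => by
        have ha : (f ^ n) a = 0 := ha
        change (f ^ (n + 1)) a = 0
        rw [hfs, ha, map_zero] }
  obtain ⟨n, hn⟩ := hR I fun n a x hx => by
    have hx : (f ^ n) x = 0 := hx
    have : ∀ m, (f ^ m) (a * x) = a * (f ^ m) x := by
      intro m
      induction m with
      | zero => rfl
      | succ m ih => rw [hfs, ih, hfs, hf, hf, mul_assoc]
    change (f ^ n) (a * x) = 0
    rw [this, hx, mul_zero]
  have hvv : v * v = v := by rw [← h, mul_assoc, ← mul_assoc β, ← mul_assoc, ← mul_assoc, h, hv, h]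
  let e := v - β * α
  have hev : ∀ m, (g ^ m) e * v = (g ^ m) e := by
    intro m
    cases m with
    | zero => change e * v = e; simp only [e, sub_mul, hvv, mul_assoc, hα]
    | succ m => rw [hgs, hg, mul_assoc, hα]
  have hfg : ∀ m, (f ^ m) ((g ^ m) e) = e := by
    intro m
    induction m with
    | zero => rfl
    | succ m ih => rw [hfs', hgs, hg, hf, mul_assoc, h, hev, ih]
  have hfe : f e = 0 := by simp only [hf, e, sub_mul, hβ, mul_assoc, h, hβ', sub_self]
  have h₁ : (g ^ n) e ∈ I (n + 1) := by
    change (f ^ (n + 1)) _ = 0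
    rw [hfs, hfg, hfe]
  rw [hn (n + 1) n.le_succ] at h₁
  have h₁ : (f ^ n) _ = 0 := h₁
  rw [hfg] at h₁
  exact (sub_eq_zero.1 h₁).symm

namespace NodeSystem

open Relation

variable {V N : Type*} {S : NodeSystem V N}

/-! ### Reduced words along paths of links -/

theorem exists_word_of_reflTransGen {a b : N × N} (h : ReflTransGen S.Link a b) :
    ∃ l, (l ++ [b]).IsChain S.Link ∧ (∃ l', l ++ [b] = a :: l') ∧
      ∀ z ∈ l ++ [b], ReflTransGen S.Link a z := by
  induction h with
  | refl => exact ⟨[], .singleton a, ⟨[], rfl⟩, by simpa using ReflTransGen.refl⟩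
  | @tail b c hab hbc ih =>
    obtain ⟨l, hl, ⟨l', hl'⟩, hz⟩ := ih
    refine ⟨l ++ [b], ?_, ⟨l' ++ [c], by rw [hl', List.cons_append]⟩, ?_⟩
    · refine List.isChain_append.2 ⟨hl, .singleton c, ?_⟩
      simpa using hbc
    · intro z hz'
      rcases List.mem_append.1 hz' with h | h
      · exact hz z h
      · rw [List.mem_singleton.1 h]
        exact hab.tail hbc

theorem isChain_starWord {l : List (N × N)} (h : l.IsChain S.Link) :
    (starWord l).IsChain S.Link := by
  rw [starWord, List.isChain_reverse, List.isChain_map]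
  exact h.imp fun _ _ h => h.swap

/-! ### Noetherian algebras with a basis of reduced words -/

variable {K : Type*} [Field K] {B : Type*} [NonUnitalRing B] [Module K B] {P : V → B}
  {X : N → N → B} {ρ : B →ₙₐ[K] Module.End K ((List (N × N) × V) →₀ K)}

/-- The algebra `B` is generated by elements `P v` and `X x t` that satisfy the relations of a
weighted Leavitt path algebra, and it acts through `ρ` on the space with basis the words; hence it
is the weighted Leavitt path algebra. -/
structure IsModel (S : NodeSystem V N) {K : Type*} [Field K] {B : Type*} [NonUnitalRing B]
    [Module K B] [IsScalarTower K B B] [SMulCommClass K B B] (P : V → B) (X : N → N → B)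
    (ρ : B →ₙₐ[K] Module.End K ((List (N × N) × V) →₀ K)) : Prop where
  isRep : S.IsRep P X
  map_vertex : ∀ v, ρ (P v) = S.vertexOp K v
  map_letter : ∀ x t, ρ (X x t) = S.letterOp K x t
  adjoin_eq_top : NonUnitalAlgebra.adjoin K (Set.range P ∪ {b | ∃ x t, b = X x t}) = ⊤

variable [IsScalarTower K B B] [SMulCommClass K B B]

namespace IsModel

theorem induction (h : S.IsModel P X ρ) {p : B → Prop} (vertex : ∀ v, p (P v))
    (letter : ∀ x t, p (X x t)) (add : ∀ b c, p b → p c → p (b + c)) (zero : p 0)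
    (mul : ∀ b c, p b → p c → p (b * c)) (smul : ∀ (k : K) b, p b → p (k • b)) (b : B) : p b := by
  have hb : b ∈ NonUnitalAlgebra.adjoin K (Set.range P ∪ {b | ∃ x t, b = X x t}) := by
    rw [h.adjoin_eq_top]; trivial
  induction hb using NonUnitalAlgebra.adjoin_induction with
  | mem b hb =>
    rcases hb with ⟨v, rfl⟩ | ⟨x, t, rfl⟩
    · exact vertex v
    · exact letter x t
  | add b c _ _ hb hc => exact add b c hb hc
  | zero => exact zero
  | mul b c _ _ hb hc => exact mul b c hb hc
  | smul k b _ hb => exact smul k b hb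

theorem apply_mem (h : S.IsModel P X ρ) {W : Submodule K ((List (N × N) × V) →₀ K)}
    (vertex : ∀ v, ∀ m ∈ W, S.vertexOp K v m ∈ W)
    (letter : ∀ x t, ∀ m ∈ W, S.letterOp K x t m ∈ W) (b : B) :
    ∀ m ∈ W, ρ b m ∈ W := by
  refine h.induction (p := fun b => ∀ m ∈ W, ρ b m ∈ W) ?_ ?_ ?_ ?_ ?_ ?_ b
  · intro v; rw [h.map_vertex]; exact vertex v
  · intro x t; rw [h.map_letter]; exact letter x t
  · intro b c hb hc m hm; rw [map_add]; exact add_mem (hb m hm) (hc m hm)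
  · intro m _; rw [map_zero]; exact zero_mem W
  · intro b c hb hc m hm; rw [map_mul]; exact hb _ (hc m hm)
  · intro k b hb m hm; rw [map_smul]; exact W.smul_mem k (hb m hm)

theorem vertex_apply (h : S.IsModel P X ρ) (v : V) :
    ρ (P v) (Finsupp.single ([], v) 1) = Finsupp.single ([], v) 1 := by
  rw [h.map_vertex, vertexOp_single, if_pos ⟨rfl, trivial⟩]

theorem wordProd_apply (h : S.IsModel P X ρ) {l : List (N × N)} {v : V} (hl : S.Reduced l v) :
    ρ (wordProd P X l v) (Finsupp.single ([], v) 1) = Finsupp.single (l, v) 1 := by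
  induction l with
  | nil => exact h.vertex_apply v
  | cons a l ih =>
    rw [wordProd_cons, map_mul, Module.End.mul_apply, ih (reduced_cons.1 hl).2.2.2, h.map_letter,
      letterOp_single_of_reduced hl]

/-- The left annihilators of the sets of all but finitely many vertices form an ascending chain. -/
theorem finite_vertices (h : S.IsModel P X ρ) (hB : IsLeftNoetherianRng B) : Finite V := by
  by_contra hV
  rw [not_finite_iff_infinite] at hV
  let f := Infinite.natEmbedding V
  let I : ℕ →o AddSubgroup B :=
    { toFun := fun n =>
        { carrier := {b | ∀ k, n ≤ k → b * P (f k) = 0}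
          add_mem' := fun ha hb k hk => by rw [add_mul, ha k hk, hb k hk, add_zero]
          zero_mem' := fun k _ => zero_mul _
          neg_mem' := fun ha k hk => by rw [neg_mul, ha k hk, neg_zero] }
      monotone' := fun m n hmn b hb k hk => hb k (hmn.trans hk) }
  obtain ⟨n, hn⟩ := hB I fun n a x hx k hk => by rw [mul_assoc, hx k hk, mul_zero]
  have h₁ : P (f n) ∈ I (n + 1) := fun k hk => by
    rw [h.isRep.vertex_mul, if_neg fun h' => by have := f.injective h'; omega]
  rw [hn (n + 1) n.le_succ] at h₁
  have h₂ : P (f n) = 0 := by rw [← h.isRep.vertex_mul_self]; exact h₁ n le_rfl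
  have h₃ := h.vertex_apply (f n)
  rw [h₂, map_zero, LinearMap.zero_apply] at h₃
  exact one_ne_zero (Finsupp.single_eq_zero.1 h₃.symm)

/-- The words that have a suffix in a set of words with nonspecial first node span a submodule:
the multiplication from the left cannot cancel these suffixes. -/
theorem apply_mem_supported (h : S.IsModel P X ρ) {Q : Set (List (N × N))}
    (hQ : ∀ q ∈ Q, ∃ a l, q = a :: l ∧ ¬ S.Special a.1) (b : B) :
    ∀ m ∈ Finsupp.supported K K {p : List (N × N) × V | ∃ q ∈ Q, q <:+ p.1},
      ρ b m ∈ Finsupp.supported K K {p : List (N × N) × V | ∃ q ∈ Q, q <:+ p.1} := by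
  refine h.apply_mem (fun v m hm => apply_mem_of_mem_supported ?_ hm)
    (fun x t m hm => apply_mem_of_mem_supported ?_ hm) b
  · rintro ⟨l, w⟩ hl
    rw [vertexOp_single]
    split_ifs
    · exact Finsupp.single_mem_supported K _ hl
    · exact zero_mem _
  · rintro ⟨l, w⟩ ⟨q, hq, hql⟩
    refine letterOp_apply_reduced (fun _ => ⟨q, hq, hql.trans (List.suffix_cons _ _)⟩) ?_
    rintro y l' rfl - ht -
    have hql' : q <:+ l' := by
      rcases List.suffix_cons_iff.1 hql with rfl | h'
      · obtain ⟨a, l, h₁, h₂⟩ := hQ _ hq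
        rw [(List.cons.inj h₁).1.symm] at h₂
        exact absurd ht h₂
      · exact h'
    exact ⟨fun _ => ⟨q, hq, hql'⟩, fun u _ _ _ =>
      ⟨q, hq, hql'.trans ((List.suffix_cons _ _).trans (List.suffix_cons _ _))⟩⟩

/-- In a left Noetherian algebra there is no infinite sequence of reduced words that begin in
nonspecial nodes and of which none is a suffix of a later one. -/
theorem exists_suffix (h : S.IsModel P X ρ) (hB : IsLeftNoetherianRng B) {q : ℕ → List (N × N)}
    {v : V} (hr : ∀ n, S.Reduced (q n) v) (hq : ∀ n, ∃ a l, q n = a :: l ∧ ¬ S.Special a.1) :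
    ∃ k n, k < n ∧ q k <:+ q n := by
  let W : ℕ → Submodule K ((List (N × N) × V) →₀ K) := fun n =>
    Finsupp.supported K K {p | ∃ r ∈ {r | ∃ k ≤ n, r = q k}, r <:+ p.1}
  let I : ℕ →o AddSubgroup B :=
    { toFun := fun n =>
        { carrier := {b : B | ρ b (Finsupp.single ([], v) 1) ∈ W n}
          add_mem' := fun ha hb => by
            change ρ _ _ ∈ W n
            rw [map_add, LinearMap.add_apply]
            exact add_mem ha hb
          zero_mem' := by
            change ρ _ _ ∈ W n
            rw [map_zero, LinearMap.zero_apply]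
            exact zero_mem _
          neg_mem' := fun ha => by
            change ρ _ _ ∈ W n
            rw [map_neg, LinearMap.neg_apply]
            exact neg_mem ha }
      monotone' := fun m n hmn b hb => by
        refine Finsupp.supported_mono (M := K) (R := K) ?_ hb
        rintro p ⟨r, ⟨k, hk, rfl⟩, hp⟩
        exact ⟨_, ⟨k, hk.trans hmn, rfl⟩, hp⟩ }
  obtain ⟨n, hn⟩ := hB I fun n b x hx => by
    change ρ (b * x) _ ∈ W n
    rw [map_mul, Module.End.mul_apply]
    refine h.apply_mem_supported ?_ b _ hx
    rintro _ ⟨k, -, rfl⟩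
    exact hq k
  have h₁ : wordProd P X (q (n + 1)) v ∈ I (n + 1) := by
    change ρ _ _ ∈ W (n + 1)
    rw [h.wordProd_apply (hr _)]
    exact Finsupp.single_mem_supported K _ ⟨_, ⟨n + 1, le_rfl, rfl⟩, List.suffix_refl _⟩
  rw [hn (n + 1) n.le_succ] at h₁
  have h₁ : ρ _ _ ∈ W n := h₁
  rw [h.wordProd_apply (hr _), Finsupp.mem_supported, Finsupp.support_single _ one_ne_zero]
    at h₁
  obtain ⟨_, ⟨k, hk, rfl⟩, hs⟩ := h₁ (Finset.mem_coe.2 (Finset.mem_singleton_self _))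
  exact ⟨k, n + 1, Nat.lt_succ_of_le hk, hs⟩

/-- If a path `y` enters a closed path `d` otherwise than by its last letter, then none of the words
`y dⁿ` is a suffix of another. -/
theorem noBranch (h : S.IsModel P X ρ) (hB : IsLeftNoetherianRng B) : S.NoBranch := by
  intro a c b b' ha hac hcb hbb' hb'b
  obtain ⟨l₁, hl₁, ⟨l₁', hl₁'⟩, -⟩ := exists_word_of_reflTransGen hac
  obtain ⟨l₂, hl₂, ⟨l₂', hl₂'⟩, -⟩ := exists_word_of_reflTransGen hbb'
  let r : ℕ → List (N × N) := fun n => (List.replicate n (l₂ ++ [b'])).flatten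
  have hr0 : r 0 = [] := rfl
  have hrs : ∀ n, r (n + 1) = l₂ ++ [b'] ++ r n := fun n => by
    simp only [r, List.replicate_succ, List.flatten_cons]
  have hr : ∀ m n, r (m + n) = r m ++ r n := fun m n => by
    simp only [r, List.replicate_add, List.flatten_append]
  -- a word that ends in a letter linked to `b` can be followed by any number of rounds
  have happ : ∀ {l d}, (l ++ [d]).IsChain S.Link → S.Link d b → ∀ n, S.Reduced (r n) (S.vtx b.1) →
      S.Reduced (l ++ [d] ++ r n) (S.vtx b.1) := by
    intro l d hl hd n hn
    cases n with
    | zero =>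
      rw [hr0, List.append_nil, ← hd.2.2.1]
      exact reduced_append_singleton hd.1 hl
    | succ n =>
      rw [hrs, hl₂', List.cons_append] at hn ⊢
      exact reduced_append_cons hl hd hn
  have hred : ∀ n, S.Reduced (r n) (S.vtx b.1) := by
    intro n
    induction n with
    | zero => exact trivial
    | succ n ih => rw [hrs]; exact happ hl₂ hb'b n ih
  obtain ⟨k, n, hkn, hs⟩ := h.exists_suffix hB (q := fun n => l₁ ++ [c] ++ r n)
    (fun n => happ hl₁ hcb n (hred n)) fun n => ⟨a, l₁' ++ r n, by rw [hl₁', List.cons_append], ha⟩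
  obtain ⟨s, hs⟩ := hs
  obtain ⟨m, rfl⟩ : ∃ m, n = m + 1 + k := ⟨n - k - 1, by omega⟩
  rw [hr (m + 1) k, hr m 1, hrs, hr0] at hs
  simp only [← List.append_assoc, List.append_nil] at hs
  have := congrArg List.getLast? (List.append_cancel_right hs)
  rw [List.getLast?_concat, List.getLast?_concat] at this
  exact Option.some.inj this

/-- If `c` is such a closed path, then `c c*` is a vertex, but `c* c` is a reduced word. -/
theorem noIsometry (h : S.IsModel P X ρ) (hB : IsLeftNoetherianRng B) : S.NoIsometry := by
  intro a ha haa hu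
  obtain ⟨b, hab, hba⟩ := TransGen.tail'_iff.1 haa
  obtain ⟨l, hl, ⟨l', hl'⟩, hz⟩ := exists_word_of_reflTransGen hab
  have hR := h.isRep
  have hv := hba.2.2.1
  have hred : S.Reduced (l ++ [b]) (S.vtx a.1) := hv ▸ reduced_append_singleton hba.1 hl
  have hstart : S.start (l ++ [b]) (S.vtx a.1) = S.vtx a.1 := by rw [hl']; rfl
  have hstar : S.start (starWord (l ++ [b])) (S.vtx a.1) = S.vtx a.1 := by
    rw [← hv]; simp [starWord, start]
  have h₁ := hR.wordProd_mul_starWord hred fun z hz' => hu z (hz z hz')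
  have h₂ := hR.vertex_mul_wordProd (l ++ [b]) (S.vtx a.1)
  have h₃ := hR.vertex_mul_wordProd (starWord (l ++ [b])) (S.vtx a.1)
  rw [hstart] at h₁ h₂
  rw [hstar] at h₃
  have h₄ := hB.mul_eq_of_mul_eq h₁ h₂ (hR.wordProd_mul_vertex _ _) h₃ (hR.wordProd_mul_vertex _ _)
  have h₅ := hR.wordProd_append (starWord (l ++ [b])) (l ++ [b]) (S.vtx a.1)
  rw [hstart, h₄] at h₅
  -- both `c* c` and the vertex are reduced words
  have hred' : S.Reduced (starWord (l ++ [b]) ++ (l ++ [b])) (S.vtx a.1) := by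
    have hc := isChain_starWord hl
    rw [hl', starWord_cons] at hc ⊢
    rw [hl'] at hred
    exact reduced_append_cons hc (swap_link_self (valid_of_transGen_self haa) ha) hred
  have h₆ := h.wordProd_apply hred'
  rw [h₅, h.vertex_apply] at h₆
  have := (Finsupp.single_left_inj one_ne_zero).1 h₆
  simp at this

/-! ### Homogeneous components -/

theorem wordLin_apply (h : S.IsModel P X ρ) (b : B) (m : (List (N × N) × V) →₀ K) :
    S.wordLin K P X (ρ b m) = b * S.wordLin K P X m := by
  refine h.induction (p := fun b => ∀ m, S.wordLin K P X (ρ b m) = b * S.wordLin K P X m)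
    ?_ ?_ ?_ ?_ ?_ ?_ b m
  · intro v m; rw [h.map_vertex, h.isRep.wordLin_vertexOp]
  · intro x t m; rw [h.map_letter, h.isRep.wordLin_letterOp]
  · intro b c hb hc m; rw [map_add, LinearMap.add_apply, map_add, hb, hc, add_mul]
  · intro m; rw [map_zero, LinearMap.zero_apply, map_zero, zero_mul]
  · intro b c hb hc m; rw [map_mul, Module.End.mul_apply, hb, hc, mul_assoc]
  · intro k b hb m; rw [map_smul, LinearMap.smul_apply, map_smul, hb, smul_mul_assoc]

/-- The reduced words that end at `v` span the left ideal generated by `v`. -/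
theorem mul_vertex_eq (h : S.IsModel P X ρ) (b : B) (v : V) :
    b * P v = S.wordLin K P X (ρ b (Finsupp.single ([], v) 1)) := by
  rw [h.wordLin_apply, wordLin_single,
    if_pos (show S.Reduced [] v from trivial)]
  rfl

theorem finiteDimensional_heightSpan (h : S.IsModel P X ρ) (hB : IsLeftNoetherianRng B) [Finite N]
    (k : ℤ) : FiniteDimensional K (S.heightSpan K k) := by
  have := h.finite_vertices hB
  have hfin : {p : List (N × N) × V | S.Reduced p.1 p.2 ∧ (p.1.map S.height).sum = k}.Finite := by
    refine ((finite_setOf_isChain (h.noBranch hB) (h.noIsometry hB) k).prod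
      (Set.finite_univ (α := V))).subset ?_
    rintro ⟨l, v⟩ ⟨h₁, h₂⟩
    exact ⟨⟨h₁.isChain, h₂⟩, trivial⟩
  rw [heightSpan, Finsupp.supported_eq_span_single]
  exact FiniteDimensional.span_of_finite K (hfin.image _)

end IsModel

end NodeSystem

/-! ### Universal properties -/

namespace AlgQuotient

variable {K A B : Type*} [Field K] [NonUnitalRing A] [Module K A] [NonUnitalRing B] [Module K B]
  {S : Set A}

/-- A homomorphism that vanishes on `S` factors through the quotient by the ideal generated
by `S`. -/
def lift (f : A →ₙₐ[K] B) (hf : ∀ x ∈ S, f x = 0) : AlgQuotient K S →ₙₐ[K] B :=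
  have h : idealSpan K S ≤ LinearMap.ker (f : A →ₗ[K] B) :=
    sInf_le ⟨hf, fun a x hx => by
      have hx : f x = 0 := hx
      constructor
      · change f (a * x) = 0
        rw [map_mul, hx, mul_zero]
      · change f (x * a) = 0
        rw [map_mul, hx, zero_mul]⟩
  { (idealSpan K S).liftQ (f : A →ₗ[K] B) h with
    map_zero' := map_zero ((idealSpan K S).liftQ (f : A →ₗ[K] B) h)
    map_mul' := fun a b => by
      obtain ⟨a, rfl⟩ := mk_surjective K S a
      obtain ⟨b, rfl⟩ := mk_surjective K S b
      exact map_mul f a b }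

end AlgQuotient

namespace DirGraph

variable {V E K B : Type*} [Field K] [NonUnitalRing B] [Module K B] [IsScalarTower K B B]
  [SMulCommClass K B B]

/-- The homomorphism from the free algebra given by the images of the letters. -/
noncomputable def FreeAlg.lift {Y : Type*} (f : Y → B) : FreeAlg K Y →ₙₐ[K] B :=
  MonoidAlgebra.liftMagma K (FreeSemigroup.lift f)

theorem FreeAlg.lift_letter {Y : Type*} (f : Y → B) (y : Y) :
    FreeAlg.lift f (FreeAlg.letter K y) = f y := by
  simp [FreeAlg.lift, FreeAlg.letter]

open scoped Classical in
/-- The homomorphism from the path algebra given by the images of the vertices and the edges. -/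
noncomputable def PathAlgebra.lift (G : DirGraph V E) (f : V ⊕ E → B)
    (h₁ : ∀ u v, f (Sum.inl u) * f (Sum.inl v) = if u = v then f (Sum.inl u) else 0)
    (h₂ : ∀ e, f (Sum.inl (G.s e)) * f (Sum.inr e) = f (Sum.inr e))
    (h₃ : ∀ e, f (Sum.inr e) * f (Sum.inl (G.r e)) = f (Sum.inr e)) : G.PathAlgebra K →ₙₐ[K] B :=
  AlgQuotient.lift (FreeAlg.lift f) (by
    rintro _ (⟨u, v⟩ | e | e)
    · rw [map_sub, map_mul, FreeAlg.lift_letter, FreeAlg.lift_letter, h₁,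
        apply_ite (FreeAlg.lift f), FreeAlg.lift_letter, map_zero, sub_self]
    · rw [map_sub, map_mul, FreeAlg.lift_letter, FreeAlg.lift_letter, h₂, sub_self]
    · rw [map_sub, map_mul, FreeAlg.lift_letter, FreeAlg.lift_letter, h₃, sub_self])

theorem PathAlgebra.lift_letter (G : DirGraph V E) (f : V ⊕ E → B) (h₁ h₂ h₃) (y : V ⊕ E) :
    PathAlgebra.lift (K := K) G f h₁ h₂ h₃ (PathAlgebra.letter G K y) = f y :=
  FreeAlg.lift_letter f y

end DirGraph

namespace WeightedGraph

variable {V E : Type*} (G : WeightedGraph V E)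

/-! ### The nodes of a weighted graph -/

theorem mem_out {e : E} {v : V} : e ∈ G.out v ↔ G.s e = v := by
  simp [out]

theorem w_le_vertexWeight (e : E) : G.w e ≤ G.vertexWeight (G.s e) :=
  Finset.le_sup (f := G.w) (G.mem_out.2 rfl)

theorem exists_w_eq_vertexWeight {v : V} (hv : 0 < G.vertexWeight v) :
    ∃ e, G.s e = v ∧ G.w e = G.vertexWeight v := by
  have hne : (G.out v).Nonempty := by
    by_contra h
    rw [Finset.not_nonempty_iff_eq_empty] at h
    simp [vertexWeight, h] at hv
  obtain ⟨e, he, h⟩ := Finset.exists_mem_eq_sup (G.out v) hne G.w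
  exact ⟨e, G.mem_out.1 he, h.symm⟩

/-- An edge of maximal weight emitted by a vertex. -/
noncomputable def maxEdge (v : V) (hv : 0 < G.vertexWeight v) : E :=
  (G.exists_w_eq_vertexWeight hv).choose

theorem s_maxEdge {v : V} (hv : 0 < G.vertexWeight v) : G.s (G.maxEdge v hv) = v :=
  (G.exists_w_eq_vertexWeight hv).choose_spec.1

theorem w_maxEdge {v : V} (hv : 0 < G.vertexWeight v) :
    G.w (G.maxEdge v hv) = G.vertexWeight v :=
  (G.exists_w_eq_vertexWeight hv).choose_spec.2

/-- The row indices `(v, i)`, with `i` less than the weight of `v`, and the column indices `e` of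
the matrices with entries `e_{i+1}` at `((v, i), e)`. -/
abbrev Node : Type _ := (Σ v, Fin (G.vertexWeight v)) ⊕ E

/-- The row of the letter `e_{i+1}`. -/
def rowNode (e : E) (i : Fin (G.w e)) : Σ v, Fin (G.vertexWeight v) :=
  ⟨G.s e, ⟨i, i.2.trans_le (G.w_le_vertexWeight e)⟩⟩

theorem rowNode_injective (e : E) : Function.Injective (G.rowNode e) := by
  intro i j h
  have h := eq_of_heq (Sigma.mk.inj h).2
  exact Fin.ext (Fin.mk.inj h)

/-- The nodes that share a nonzero entry with a given node. -/
noncomputable def nodeNbr : G.Node → Finset G.Node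
  | Sum.inl p => ((G.out p.1).filter fun e => (p.2 : ℕ) < G.w e).map Function.Embedding.inr
  | Sum.inr e => (Finset.univ : Finset (Fin (G.w e))).map
      ⟨fun i => Sum.inl (G.rowNode e i), fun _ _ h => G.rowNode_injective e (Sum.inl.inj h)⟩

theorem inr_mem_nodeNbr {p : Σ v, Fin (G.vertexWeight v)} {e : E} :
    Sum.inr e ∈ G.nodeNbr (Sum.inl p) ↔ G.s e = p.1 ∧ (p.2 : ℕ) < G.w e := by
  simp [nodeNbr, mem_out]

theorem inl_mem_nodeNbr {p : Σ v, Fin (G.vertexWeight v)} {e : E} :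
    Sum.inl p ∈ G.nodeNbr (Sum.inr e) ↔ G.s e = p.1 ∧ (p.2 : ℕ) < G.w e := by
  simp only [nodeNbr, Finset.mem_map, Finset.mem_univ, true_and]
  constructor
  · rintro ⟨i, h⟩
    obtain rfl := Sum.inl.inj h
    exact ⟨rfl, i.2⟩
  · obtain ⟨v, i⟩ := p
    rintro ⟨rfl, h⟩
    exact ⟨⟨i, h⟩, rfl⟩

theorem inl_notMem_nodeNbr {p q : Σ v, Fin (G.vertexWeight v)} :
    Sum.inl p ∉ G.nodeNbr (Sum.inl q) := by
  simp [nodeNbr]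

theorem inr_notMem_nodeNbr {e f : E} : Sum.inr e ∉ G.nodeNbr (Sum.inr f) := by
  simp [nodeNbr]

/-- The special column is that of an edge of maximal weight, the special row the first one. -/
noncomputable def nodeSp : G.Node → G.Node
  | Sum.inl p => Sum.inr (G.maxEdge p.1 (p.2.1.zero_le.trans_lt p.2.2))
  | Sum.inr e => Sum.inl (G.rowNode e ⟨0, G.w_pos e⟩)

theorem fst_eq_of_nodeSp_eq {p q : Σ v, Fin (G.vertexWeight v)}
    (h : G.nodeSp (Sum.inl p) = G.nodeSp (Sum.inl q)) : p.1 = q.1 := by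
  have h := congrArg G.s (Sum.inr.inj h)
  rwa [s_maxEdge, s_maxEdge] at h

theorem nodeSp_inl_eq {p q : Σ v, Fin (G.vertexWeight v)} (h : p.1 = q.1) :
    G.nodeSp (Sum.inl p) = G.nodeSp (Sum.inl q) := by
  obtain ⟨v, i⟩ := p
  obtain ⟨w, j⟩ := q
  obtain rfl : v = w := h
  rfl

theorem s_eq_of_nodeSp_eq {e f : E} (h : G.nodeSp (Sum.inr e) = G.nodeSp (Sum.inr f)) :
    G.s e = G.s f :=
  congrArg Sigma.fst (Sum.inl.inj h)

theorem nodeSp_inr_eq {e f : E} (h : G.s e = G.s f) :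
    G.nodeSp (Sum.inr e) = G.nodeSp (Sum.inr f) := by
  have : ∀ (v w : V) (hv : 0 < G.vertexWeight v) (hw : 0 < G.vertexWeight w), v = w →
      (⟨v, ⟨0, hv⟩⟩ : Σ v, Fin (G.vertexWeight v)) = ⟨w, ⟨0, hw⟩⟩ := by
    rintro v _ _ _ rfl
    rfl
  exact congrArg Sum.inl (this _ _ _ _ h)

/-- The row and column indices of a weighted graph. -/
noncomputable def nodes : NodeSystem V G.Node where
  vtx := Sum.elim Sigma.fst G.r
  nbr := G.nodeNbr
  sp := G.nodeSp
  row x := x.isLeft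
  mem_symm {x t} h := by
    rcases x with p | e <;> rcases t with q | f
    · exact absurd h G.inl_notMem_nodeNbr
    · exact G.inl_mem_nodeNbr.2 (G.inr_mem_nodeNbr.1 h)
    · exact G.inr_mem_nodeNbr.2 (G.inl_mem_nodeNbr.1 h)
    · exact absurd h G.inr_notMem_nodeNbr
  sp_mem x := by
    rcases x with p | e
    · exact G.inr_mem_nodeNbr.2 ⟨G.s_maxEdge _, (G.w_maxEdge _).symm ▸ p.2.2⟩
    · exact G.inl_mem_nodeNbr.2 ⟨rfl, G.w_pos e⟩
  sp_eq {x y t} hx hy := by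
    rcases x with p | e <;> rcases y with q | f <;> rcases t with r | g
    · exact absurd hx G.inl_notMem_nodeNbr
    · exact G.nodeSp_inl_eq ((G.inr_mem_nodeNbr.1 hx).1.symm.trans (G.inr_mem_nodeNbr.1 hy).1)
    · exact absurd hx G.inl_notMem_nodeNbr
    · exact absurd hy G.inr_notMem_nodeNbr
    · exact absurd hy G.inl_notMem_nodeNbr
    · exact absurd hx G.inr_notMem_nodeNbr
    · exact G.nodeSp_inr_eq ((G.inl_mem_nodeNbr.1 hx).1.trans (G.inl_mem_nodeNbr.1 hy).1.symm)
    · exact absurd hx G.inr_notMem_nodeNbr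
  row_iff {x t} h := by
    rcases x with p | e <;> rcases t with q | f
    · exact absurd h G.inl_notMem_nodeNbr
    · simp
    · simp
    · exact absurd h G.inr_notMem_nodeNbr
  vtx_sp_sp {x} hx := by
    rcases x with p | e
    · exact G.s_maxEdge _
    · simp at hx
  sp_eq_of_row {x y} hx hy h := by
    rcases x with p | e <;> rcases y with q | f
    · exact G.nodeSp_inl_eq h
    · simp at hy
    · simp at hx
    · simp at hx

/-! ### The generators of the weighted Leavitt path algebra -/

variable (K : Type*) [Field K]

open scoped Classical in
theorem dVertex_mul_dVertex (u v : V) :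
    G.dVertex K u * G.dVertex K v = if u = v then G.dVertex K u else 0 := by
  have h := (AlgQuotient.mk_eq_mk K {x | G.hat.double.PathRelator K x}).2 (subset_idealSpan K _
    (DirGraph.PathRelator.vertex (G := G.hat.double) (K := K) u v))
  refine h.trans ?_
  split_ifs
  · rfl
  · exact map_zero (AlgQuotient.mk K {x | G.hat.double.PathRelator K x})

theorem dVertex_mul_letter (y : G.HatEdge ⊕ G.HatEdge) :
    G.dVertex K (G.hat.double.s y) * DirGraph.PathAlgebra.letter G.hat.double K (Sum.inr y) =
      DirGraph.PathAlgebra.letter G.hat.double K (Sum.inr y) :=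
  (AlgQuotient.mk_eq_mk K _).2 (subset_idealSpan K _
    (DirGraph.PathRelator.source (G := G.hat.double) (K := K) y))

theorem letter_mul_dVertex (y : G.HatEdge ⊕ G.HatEdge) :
    DirGraph.PathAlgebra.letter G.hat.double K (Sum.inr y) * G.dVertex K (G.hat.double.r y) =
      DirGraph.PathAlgebra.letter G.hat.double K (Sum.inr y) :=
  (AlgQuotient.mk_eq_mk K _).2 (subset_idealSpan K _
    (DirGraph.PathRelator.range (G := G.hat.double) (K := K) y))

theorem dVertex_mul_dReal (e : E) (i : ℕ) :
    G.dVertex K (G.s e) * G.dReal K e i = G.dReal K e i := by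
  unfold dReal
  split_ifs with h
  · exact G.dVertex_mul_letter K (Sum.inl ⟨e, ⟨i, h⟩⟩)
  · exact mul_zero _

theorem dReal_mul_dVertex (e : E) (i : ℕ) :
    G.dReal K e i * G.dVertex K (G.r e) = G.dReal K e i := by
  unfold dReal
  split_ifs with h
  · exact G.letter_mul_dVertex K (Sum.inl ⟨e, ⟨i, h⟩⟩)
  · exact zero_mul _

theorem dVertex_mul_dGhost (e : E) (i : ℕ) :
    G.dVertex K (G.r e) * G.dGhost K e i = G.dGhost K e i := by
  unfold dGhost
  split_ifs with h
  · exact G.dVertex_mul_letter K (Sum.inr ⟨e, ⟨i, h⟩⟩)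
  · exact mul_zero _

theorem dGhost_mul_dVertex (e : E) (i : ℕ) :
    G.dGhost K e i * G.dVertex K (G.s e) = G.dGhost K e i := by
  unfold dGhost
  split_ifs with h
  · exact G.letter_mul_dVertex K (Sum.inr ⟨e, ⟨i, h⟩⟩)
  · exact zero_mul _

/-- The projection onto the weighted Leavitt path algebra. -/
noncomputable abbrev proj : G.DPathAlgebra K →ₗ[K] G.LeavittPathAlgebra K := AlgQuotient.mk K _

/-- A vertex in the weighted Leavitt path algebra. -/
noncomputable def vertex (v : V) : G.LeavittPathAlgebra K := G.proj K (G.dVertex K v)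

open scoped Classical in
/-- The entry at a row and a column (a real edge) or at a column and a row (a ghost edge); it is
zero if there is no such edge. -/
noncomputable def entry : G.Node → G.Node → G.LeavittPathAlgebra K
  | Sum.inl p, Sum.inr e => if G.s e = p.1 then G.proj K (G.dReal K e p.2) else 0
  | Sum.inr e, Sum.inl p => if G.s e = p.1 then G.proj K (G.dGhost K e p.2) else 0
  | _, _ => 0

open scoped Classical in
theorem sum_dReal_mul_dGhost (v : V) {i j : ℕ} (hi : i < G.vertexWeight v)
    (hj : j < G.vertexWeight v) :
    ∑ e ∈ G.out v, G.proj K (G.dReal K e i) * G.proj K (G.dGhost K e j) =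
      if i = j then G.vertex K v else 0 := by
  have h := (AlgQuotient.mk_eq_mk K {x | G.LeavittRelator K x}).2 (subset_idealSpan K _
    (LeavittRelator.row (G := G) (K := K) v i j hi hj))
  simp only [← AlgQuotient.mk_mul, ← map_sum]
  refine h.trans ?_
  split_ifs
  · rfl
  · exact map_zero (G.proj K)

open scoped Classical in
theorem sum_dGhost_mul_dReal {e f : E} (hef : G.s e = G.s f) :
    ∑ i : Fin (G.w e), G.proj K (G.dGhost K e i) * G.proj K (G.dReal K f i) =
      if e = f then G.vertex K (G.r e) else 0 := by
  have h := (AlgQuotient.mk_eq_mk K {x | G.LeavittRelator K x}).2 (subset_idealSpan K _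
    (LeavittRelator.col (G := G) (K := K) (G.s e) e f rfl hef.symm))
  rw [Fin.sum_univ_eq_sum_range
    (fun i => G.proj K (G.dGhost K e i) * G.proj K (G.dReal K f i)),
    Finset.sum_subset (Finset.range_mono (G.w_le_vertexWeight e)) (by
      intro i _ hi
      rw [Finset.mem_range] at hi
      rw [dGhost, dif_neg hi, map_zero, zero_mul])]
  simp only [← AlgQuotient.mk_mul, ← map_sum]
  refine h.trans ?_
  split_ifs
  · rfl
  · exact map_zero (G.proj K)

theorem isRep : G.nodes.IsRep (G.vertex K) (G.entry K) where
  vertex_mul u v := by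
    rw [vertex, vertex, ← AlgQuotient.mk_mul, dVertex_mul_dVertex]
    split_ifs
    · rfl
    · exact map_zero _
  vertex_mul_letter x t := by
    rcases x with p | e <;> rcases t with q | f
    · exact mul_zero _
    · simp only [entry]
      split_ifs with h
      · rw [vertex, ← AlgQuotient.mk_mul, show G.nodes.vtx (Sum.inl p) = G.s f from h.symm,
          dVertex_mul_dReal]
      · exact mul_zero _
    · simp only [entry]
      split_ifs with h
      · rw [vertex, ← AlgQuotient.mk_mul, show G.nodes.vtx (Sum.inr e) = G.r e from rfl,
          dVertex_mul_dGhost]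
      · exact mul_zero _
    · exact mul_zero _
  letter_mul_vertex x t := by
    rcases x with p | e <;> rcases t with q | f
    · exact zero_mul _
    · simp only [entry]
      split_ifs with h
      · rw [vertex, ← AlgQuotient.mk_mul, show G.nodes.vtx (Sum.inr f) = G.r f from rfl,
          dReal_mul_dVertex]
      · exact zero_mul _
    · simp only [entry]
      split_ifs with h
      · rw [vertex, ← AlgQuotient.mk_mul, show G.nodes.vtx (Sum.inl q) = G.s e from h.symm,
          dGhost_mul_dVertex]
      · exact zero_mul _
    · exact zero_mul _
  eq_zero x t ht := by
    rcases x with p | e <;> rcases t with q | f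
    · rfl
    · simp only [entry]
      split_ifs with h
      · rw [dReal, dif_neg fun h' => ht (G.inr_mem_nodeNbr.2 ⟨h, h'⟩), map_zero]
      · rfl
    · simp only [entry]
      split_ifs with h
      · rw [dGhost, dif_neg fun h' => ht (G.inl_mem_nodeNbr.2 ⟨h, h'⟩), map_zero]
      · rfl
    · rfl
  sum_mul x y hxy := by
    classical
    rcases x with p | e <;> rcases y with q | f
    · obtain ⟨v, i⟩ := p
      obtain ⟨w, j⟩ := q
      obtain rfl : v = w := G.fst_eq_of_nodeSp_eq hxy
      have h := G.sum_dReal_mul_dGhost K v i.2 j.2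
      change ∑ t ∈ G.nodeNbr _, _ = _
      rw [nodeNbr, Finset.sum_map, Finset.sum_filter]
      refine ((Finset.sum_congr rfl fun e he => ?_).trans h).trans ?_
      · have hs := G.mem_out.1 he
        simp only [Function.Embedding.inr_apply, entry, if_pos hs]
        split_ifs with h'
        · rfl
        · rw [dReal, dif_neg h', map_zero, zero_mul]
      · by_cases hij : i = j
        · subst hij
          simp only [if_true]
          rfl
        · rw [if_neg fun h => hij (Fin.ext h), if_neg]
          simpa using hij
    · cases hxy
    · cases hxy
    · have hs := G.s_eq_of_nodeSp_eq hxy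
      have h := G.sum_dGhost_mul_dReal K hs
      change ∑ t ∈ G.nodeNbr _, _ = _
      rw [nodeNbr, Finset.sum_map]
      refine ((Finset.sum_congr rfl fun i _ => ?_).trans h).trans ?_
      · simp only [Function.Embedding.coeFn_mk, entry, rowNode, if_true, if_pos hs.symm]
      · by_cases hef : e = f
        · subst hef
          simp only [if_true]
          rfl
        · rw [if_neg hef, if_neg]
          simpa using hef

end WeightedGraph

namespace WeightedGraph

variable {V E : Type*} (G : WeightedGraph V E)

section Lift

variable {K B : Type*} [Field K] [NonUnitalRing B] [Module K B] [IsScalarTower K B B]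
  [SMulCommClass K B B] {P : V → B} {X : G.Node → G.Node → B}

/-- The images of the generators under the homomorphism given by a representation. -/
def letterImage (P : V → B) (X : G.Node → G.Node → B) : V ⊕ (G.HatEdge ⊕ G.HatEdge) → B
  | Sum.inl v => P v
  | Sum.inr (Sum.inl y) => X (Sum.inl (G.rowNode y.1 y.2)) (Sum.inr y.1)
  | Sum.inr (Sum.inr y) => X (Sum.inr y.1) (Sum.inl (G.rowNode y.1 y.2))

/-- The homomorphism from the path algebra of the double graph given by a representation. -/
noncomputable def dLift (h : G.nodes.IsRep P X) : G.DPathAlgebra K →ₙₐ[K] B :=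
  DirGraph.PathAlgebra.lift G.hat.double (G.letterImage P X) h.vertex_mul
    (by
      rintro (y | y)
      · exact h.vertex_mul_letter (Sum.inl (G.rowNode y.1 y.2)) (Sum.inr y.1)
      · exact h.vertex_mul_letter (Sum.inr y.1) (Sum.inl (G.rowNode y.1 y.2)))
    (by
      rintro (y | y)
      · exact h.letter_mul_vertex (Sum.inl (G.rowNode y.1 y.2)) (Sum.inr y.1)
      · exact h.letter_mul_vertex (Sum.inr y.1) (Sum.inl (G.rowNode y.1 y.2)))

theorem dLift_dVertex (h : G.nodes.IsRep P X) (v : V) : G.dLift h (G.dVertex K v) = P v :=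
  DirGraph.PathAlgebra.lift_letter ..

theorem dLift_dReal (h : G.nodes.IsRep P X) {e : E} {v : V} (hs : G.s e = v)
    (i : Fin (G.vertexWeight v)) :
    G.dLift h (G.dReal K e i) = X (Sum.inl ⟨v, i⟩) (Sum.inr e) := by
  subst hs
  by_cases hi : (i : ℕ) < G.w e
  · rw [dReal, dif_pos hi]
    exact DirGraph.PathAlgebra.lift_letter ..
  · rw [dReal, dif_neg hi, map_zero, h.eq_zero _ _ fun h' => hi (G.inr_mem_nodeNbr.1 h').2]

theorem dLift_dGhost (h : G.nodes.IsRep P X) {e : E} {v : V} (hs : G.s e = v)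
    (i : Fin (G.vertexWeight v)) :
    G.dLift h (G.dGhost K e i) = X (Sum.inr e) (Sum.inl ⟨v, i⟩) := by
  subst hs
  by_cases hi : (i : ℕ) < G.w e
  · rw [dGhost, dif_pos hi]
    exact DirGraph.PathAlgebra.lift_letter ..
  · rw [dGhost, dif_neg hi, map_zero, h.eq_zero _ _ fun h' => hi (G.inl_mem_nodeNbr.1 h').2]

/-- The homomorphism from the weighted Leavitt path algebra given by a representation. -/
noncomputable def lift (h : G.nodes.IsRep P X) : G.LeavittPathAlgebra K →ₙₐ[K] B :=
  AlgQuotient.lift (G.dLift h) (by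
    classical
    rintro _ (⟨v, i, j, hi, hj⟩ | ⟨v, e, f, rfl, hf⟩)
    · have h₁ := h.sum_mul (Sum.inl ⟨v, ⟨i, hi⟩⟩) (Sum.inl ⟨v, ⟨j, hj⟩⟩) rfl
      change ∑ t ∈ G.nodeNbr _, _ = _ at h₁
      rw [nodeNbr, Finset.sum_map, Finset.sum_filter] at h₁
      rw [map_sub, sub_eq_zero, map_sum]
      refine ((Finset.sum_congr rfl fun e he => ?_).trans h₁).trans ?_
      · have hs := G.mem_out.1 he
        rw [map_mul, G.dLift_dReal h hs ⟨i, hi⟩, G.dLift_dGhost h hs ⟨j, hj⟩]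
        split_ifs with h'
        · rfl
        · rw [h.eq_zero _ _ fun h'' => h' (G.inr_mem_nodeNbr.1 h'').2, zero_mul]
      · by_cases hij : i = j
        · subst hij
          rw [if_pos rfl, if_pos rfl, dLift_dVertex]
          rfl
        · rw [if_neg hij, if_neg, map_zero]
          simpa using hij
    · have h₁ := h.sum_mul (Sum.inr e) (Sum.inr f) (G.nodeSp_inr_eq hf.symm)
      change ∑ t ∈ G.nodeNbr _, _ = _ at h₁
      rw [nodeNbr, Finset.sum_map] at h₁
      rw [map_sub, sub_eq_zero, map_sum,
        ← Finset.sum_subset (Finset.range_mono (G.w_le_vertexWeight e)) (by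
          intro i _ hi
          rw [Finset.mem_range] at hi
          rw [dGhost, dif_neg hi, zero_mul, map_zero]),
        ← Fin.sum_univ_eq_sum_range (fun i => G.dLift h (G.dGhost K e i * G.dReal K f i))]
      refine ((Finset.sum_congr rfl fun i _ => ?_).trans h₁).trans ?_
      · have hi := i.2.trans_le (G.w_le_vertexWeight e)
        rw [map_mul, G.dLift_dGhost h rfl ⟨i, hi⟩, G.dLift_dReal h hf ⟨i, hi⟩]
        rfl
      · by_cases hef : e = f
        · subst hef
          rw [if_pos rfl, if_pos rfl, dLift_dVertex]
          rfl
        · rw [if_neg hef, if_neg, map_zero]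
          simpa using hef)

theorem lift_vertex (h : G.nodes.IsRep P X) (v : V) : G.lift h (G.vertex K v) = P v :=
  G.dLift_dVertex h v

theorem lift_entry (h : G.nodes.IsRep P X) (x t : G.Node) : G.lift h (G.entry K x t) = X x t := by
  rcases x with ⟨v, i⟩ | e <;> rcases t with ⟨w, j⟩ | f
  · exact (map_zero _).trans (h.eq_zero _ _ G.inl_notMem_nodeNbr).symm
  · simp only [entry]
    split_ifs with hs
    · exact G.dLift_dReal h hs i
    · rw [map_zero, h.eq_zero _ _ fun h' => hs (G.inr_mem_nodeNbr.1 h').1]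
  · simp only [entry]
    split_ifs with hs
    · exact G.dLift_dGhost h hs j
    · rw [map_zero, h.eq_zero _ _ fun h' => hs (G.inl_mem_nodeNbr.1 h').1]
  · exact (map_zero _).trans (h.eq_zero _ _ G.inr_notMem_nodeNbr).symm

end Lift

/-! ### Words in the generators -/

variable (K : Type*) [Field K]

theorem ofWord_mul (x y : FreeSemigroup G.Letter) :
    G.ofWord K (x * y) = G.ofWord K x * G.ofWord K y := by
  have h : (MonoidAlgebra.single (x * y) 1 : DirGraph.FreeAlg K G.Letter) =
      MonoidAlgebra.single x 1 * MonoidAlgebra.single y 1 := by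
    rw [MonoidAlgebra.single_mul_single, one_mul]
  rw [ofWord, h]
  rfl

theorem ofWord_of (y : G.Letter) :
    G.ofWord K (FreeSemigroup.of y) = G.letterImage (G.vertex K) (G.entry K) y := by
  rcases y with v | ⟨e, i⟩ | ⟨e, i⟩
  · rfl
  · have h₁ : G.dReal K e i =
        DirGraph.PathAlgebra.letter G.hat.double K (Sum.inr (Sum.inl ⟨e, i⟩)) := dif_pos i.2
    have h₂ : G.entry K (Sum.inl (G.rowNode e i)) (Sum.inr e) =
        G.proj K (G.dReal K e i) := if_pos rfl
    rw [letterImage, h₂, h₁]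
    rfl
  · have h₁ : G.dGhost K e i =
        DirGraph.PathAlgebra.letter G.hat.double K (Sum.inr (Sum.inr ⟨e, i⟩)) := dif_pos i.2
    have h₂ : G.entry K (Sum.inr e) (Sum.inl (G.rowNode e i)) =
        G.proj K (G.dGhost K e i) := if_pos rfl
    rw [letterImage, h₂, h₁]
    rfl

theorem adjoin_eq_top : NonUnitalAlgebra.adjoin K
    (Set.range (G.vertex K) ∪ {b | ∃ x t, b = G.entry K x t}) = ⊤ := by
  set A := NonUnitalAlgebra.adjoin K
    (Set.range (G.vertex K) ∪ {b | ∃ x t, b = G.entry K x t}) with hA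
  have hword : ∀ x, G.ofWord K x ∈ A := by
    intro x
    induction x using FreeSemigroup.recOnMul with
    | ih1 y =>
      rw [ofWord_of, hA]
      refine NonUnitalAlgebra.subset_adjoin K ?_
      rcases y with v | y | y
      · exact Or.inl ⟨v, rfl⟩
      · exact Or.inr ⟨Sum.inl (G.rowNode y.1 y.2), Sum.inr y.1, rfl⟩
      · exact Or.inr ⟨Sum.inr y.1, Sum.inl (G.rowNode y.1 y.2), rfl⟩
    | ih2 y x hy hx => rw [ofWord_mul]; exact mul_mem hy hx
  rw [eq_top_iff]
  rintro a -
  obtain ⟨a, rfl⟩ := AlgQuotient.mk_surjective K _ a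
  obtain ⟨m, rfl⟩ := AlgQuotient.mk_surjective K _ a
  induction m using MonoidAlgebra.induction_linear with
  | zero => rw [map_zero, map_zero]; exact zero_mem A
  | add m m' hm hm' => rw [map_add, map_add]; exact add_mem hm hm'
  | single x r =>
    rw [← mul_one r, ← smul_eq_mul, ← MonoidAlgebra.smul_single, map_smul, map_smul]
    exact SMulMemClass.smul_mem r (hword x)

theorem isModel : G.nodes.IsModel (G.vertex K) (G.entry K) (G.lift (G.nodes.isRep_op K)) where
  isRep := G.isRep K
  map_vertex := G.lift_vertex _
  map_letter := G.lift_entry _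
  adjoin_eq_top := G.adjoin_eq_top K

/-! ### The involution -/

open MulOpposite in
/-- The opposite algebra is represented by the transposed matrices. -/
theorem _root_.NodeSystem.IsRep.op {V N B : Type*} {S : NodeSystem V N} [NonUnitalRing B]
    {P : V → B} {X : N → N → B} (h : S.IsRep P X) :
    S.IsRep (fun v => op (P v)) fun x t => op (X t x) where
  vertex_mul u v := by
    rw [← op_mul, h.vertex_mul]
    by_cases huv : u = v
    · subst huv; simp
    · simp [huv, Ne.symm huv]
  vertex_mul_letter x t := by rw [← op_mul, h.letter_mul_vertex]
  letter_mul_vertex x t := by rw [← op_mul, h.vertex_mul_letter]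
  eq_zero x t ht := by rw [h.eq_zero t x fun h' => ht (S.mem_symm h'), op_zero]
  sum_mul x y hxy := by
    have h₁ := h.sum_mul y x hxy.symm
    have h₂ : ∑ t ∈ S.nbr x, X y t * X t x = ∑ t ∈ S.nbr y, X y t * X t x :=
      Finset.sum_congr_of_eq_on_inter
        (fun t _ ht => by rw [h.eq_zero y t ht, zero_mul])
        (fun t _ ht => by rw [h.eq_zero t x fun h' => ht (S.mem_symm h'), mul_zero])
        fun _ _ _ => rfl
    simp only [← op_mul]
    rw [← Finset.op_sum, h₂, h₁]
    by_cases hyx : y = x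
    · subst hyx; simp
    · simp [hyx, Ne.symm hyx]

/-- A right Noetherian ring with an involution is left Noetherian. -/
theorem _root_.IsRightNoetherianRng.isLeftNoetherianRng {R : Type*} [NonUnitalRing R]
    (hR : IsRightNoetherianRng R) (τ : R →ₙ+* Rᵐᵒᵖ)
    (hτ : ∀ a, (τ (τ a).unop).unop = a) : IsLeftNoetherianRng R := by
  intro I hI
  let J : ℕ →o AddSubgroup R :=
    { toFun := fun n =>
        (I n).comap (MulOpposite.opAddEquiv.symm.toAddMonoidHom.comp (τ : R →+ Rᵐᵒᵖ))
      monotone' := fun m n hmn => AddSubgroup.comap_mono (I.monotone hmn) }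
  obtain ⟨n, hn⟩ := hR J fun n a x hx => by
    change (τ (x * a)).unop ∈ I n
    rw [map_mul, MulOpposite.unop_mul]
    exact hI n _ _ hx
  refine ⟨n, fun m hm => ?_⟩
  ext x
  have := SetLike.ext_iff.1 (hn m hm) (τ x).unop
  change (τ (τ x).unop).unop ∈ I m ↔ (τ (τ x).unop).unop ∈ I n at this
  rwa [hτ] at this

theorem isLeftNoetherianRng_of_isRightNoetherianRng
    (h : IsRightNoetherianRng (G.LeavittPathAlgebra K)) :
    IsLeftNoetherianRng (G.LeavittPathAlgebra K) := by
  let σ := G.lift (K := K) (G.isRep K).op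
  have hσ : ∀ a, (σ (σ a).unop).unop = a := by
    refine (G.isModel K).induction (p := fun a => (σ (σ a).unop).unop = a) ?_ ?_ ?_ ?_ ?_ ?_
    · intro v; simp only [σ, lift_vertex, MulOpposite.unop_op]
    · intro x t; simp only [σ, lift_entry, MulOpposite.unop_op]
    · intro b c hb hc; simp only [map_add, MulOpposite.unop_add, hb, hc]
    · simp only [map_zero, MulOpposite.unop_zero]
    · intro b c hb hc; simp only [map_mul, MulOpposite.unop_mul, hb, hc]
    · intro k b hb; simp only [map_smul, MulOpposite.unop_smul, hb]
  exact h.isLeftNoetherianRng (σ : G.LeavittPathAlgebra K →ₙ+* (G.LeavittPathAlgebra K)ᵐᵒᵖ) hσ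

/-! ### The grading -/

/-- The sum of the coordinates in the grading group. -/
noncomputable def totalDegree : G.GradeGroup →+ ℤ :=
  Finsupp.liftAddHom fun _ => AddMonoidHom.id ℤ

theorem wordDegree_mul (x y : FreeSemigroup G.Letter) :
    G.wordDegree (x * y) = G.wordDegree x + G.wordDegree y := by
  rw [wordDegree, map_mul, toAdd_mul]
  rfl

theorem wordDegree_of (y : G.Letter) : G.wordDegree (FreeSemigroup.of y) = G.letterDegree y := by
  simp [wordDegree]

theorem apply_ofWord_mem_heightSpan (x : FreeSemigroup G.Letter) :
    ∀ {k : ℤ} {m : (List (G.Node × G.Node) × V) →₀ K}, m ∈ G.nodes.heightSpan K k →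
      G.lift (G.nodes.isRep_op K) (G.ofWord K x) m ∈
        G.nodes.heightSpan K (k + G.totalDegree (G.wordDegree x)) := by
  have hM := G.isModel K
  induction x using FreeSemigroup.recOnMul with
  | ih1 y =>
    intro k m hm
    rw [ofWord_of, wordDegree_of]
    rcases y with v | y | y
    · rw [letterImage, hM.map_vertex, letterDegree, map_zero, add_zero]
      exact NodeSystem.vertexOp_mem_heightSpan v hm
    · rw [letterImage, hM.map_letter]
      convert NodeSystem.letterOp_mem_heightSpan _ _ hm
      simp [letterDegree, totalDegree, NodeSystem.height, nodes]
    · rw [letterImage, hM.map_letter]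
      convert NodeSystem.letterOp_mem_heightSpan _ _ hm
      rw [letterDegree, map_neg]
      simp [totalDegree, NodeSystem.height, nodes]
  | ih2 y x hy hx =>
    intro k m hm
    rw [ofWord_mul, map_mul, Module.End.mul_apply, wordDegree_mul, map_add,
      add_comm (G.totalDegree _), ← add_assoc]
    exact hy (hx hm)

theorem exists_ofWord_mul_vertex (x : FreeSemigroup G.Letter) :
    ∃ v, G.ofWord K x * G.vertex K v = G.ofWord K x := by
  induction x using FreeSemigroup.recOnMul with
  | ih1 y =>
    rw [ofWord_of]
    rcases y with v | y | y
    · exact ⟨v, (G.isRep K).vertex_mul_self v⟩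
    · exact ⟨_, (G.isRep K).letter_mul_vertex (Sum.inl (G.rowNode y.1 y.2)) (Sum.inr y.1)⟩
    · exact ⟨_, (G.isRep K).letter_mul_vertex (Sum.inr y.1) (Sum.inl (G.rowNode y.1 y.2))⟩
  | ih2 y x _ hx =>
    obtain ⟨v, hv⟩ := hx
    exact ⟨v, by rw [ofWord_mul, mul_assoc, hv]⟩

theorem homogeneousComponent_le (g : G.GradeGroup) : G.homogeneousComponent K g ≤
    (G.nodes.heightSpan K (G.totalDegree g)).map
      (G.nodes.wordLin K (G.vertex K) (G.entry K)) := by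
  refine Submodule.span_le.2 ?_
  rintro _ ⟨x, rfl, rfl⟩
  obtain ⟨v, hv⟩ := G.exists_ofWord_mul_vertex K x
  refine ⟨_, ?_, ((G.isModel K).mul_vertex_eq _ v).symm.trans hv⟩
  have h₀ : Finsupp.single ([], v) (1 : K) ∈ G.nodes.heightSpan K 0 :=
    Finsupp.single_mem_supported K _ ⟨trivial, rfl⟩
  simpa using G.apply_ofWord_mem_heightSpan K x h₀

theorem finite_edges {V E : Type*} (G : WeightedGraph V E) [Finite V] : Finite E := by
  have : (⋃ v, {e | G.s e = v}) = Set.univ := by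
    ext e
    simp
  rw [← Set.finite_univ_iff, ← this]
  exact Set.finite_iUnion G.rowFinite

end WeightedGraph

theorem mainTheorem4 {V E K : Type*} [Field K] (G : WeightedGraph V E)
    (hN : IsLeftNoetherianRng (G.LeavittPathAlgebra K) ∨
      IsRightNoetherianRng (G.LeavittPathAlgebra K)) :
    G.IsLocallyFinite K := by
  have hL : IsLeftNoetherianRng (G.LeavittPathAlgebra K) :=
    hN.elim id (G.isLeftNoetherianRng_of_isRightNoetherianRng K)
  have hM := G.isModel K
  have := hM.finite_vertices hL
  have := G.finite_edges
  intro g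
  have := hM.finiteDimensional_heightSpan hL (G.totalDegree g)
  exact Submodule.finiteDimensional_of_le (G.homogeneousComponent_le K g)
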